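/- Write $[n]=\{1,\dots,n\}$ with $n\ge 1$, indices taken modulo $n$. For $r\in[n]$ let $<_r$ be the cyclic order $r<_r r+1<_r\cdots<_r r-1$ on $[n]$, and for sets $A=\{a_1<_r\cdots<_r a_k\}$, $B=\{b_1<_r\cdots<_r b_k\}$ of the same size write $A\le_r B$ if $a_i\le_r b_i$ for all $i$ (sets of different sizes are incomparable). A decorated permutation $\pi^{:}=(\pi,col)$ is a permutation $\pi\in S_n$ with a map $col$ from the fixed points of $\pi$ to $\{1,-1\}$. Its Grassmann necklace is $I_r=\{i : i<_r\pi^{-1}(i)\}\cup\{i : \pi(i)=i,\ col(i)=-1\}$, $r\in[n]$, and its positroid is the family of bases $$\mathcal M_{\pi^{:}}=\{H\subseteq[n] : I_t\le_t H \text{ for all } t\in[n]\}.$$ For a family $\mathcal M$ of subsets of $[n]$ and $j\in[n]$, the restriction of $\mathcal M$ to $[n]\setminus\{j\}$ (the deletion of $j$) is $\mathcal M'=\{H\in\mathcal M : j\notin H\}$, regarded as a family of subsets of $[n]$. We say that $\mu^{:}$ is the decorated permutation of $\mathcal M'$ if $\mathcal M_{\mu^{:}}=\mathcal M'$; by convention,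 if $\mathcal M'$ has no members, its decorated permutation is the identity with all colours $+1$. **Theorem.** Let $\pi^{:}=(\pi,col)$ be a decorated permutation, let $j\in[n]$ and let $\mathcal M'$ be the restriction of $\mathcal M_{\pi^{:}}$ to $[n]\setminus\{j\}$. Then $\mathcal M'$ has exactly one decorated permutation $\mu^{:}=(\mu,col')$, and it is the following. 1. If $\pi(j)\ne j$, then $\mathcal M_{\mu^{:}}=\mathcal M'$, and the following algorithm terminates with output $\mu^{:}$. Start with $\mu\Leftarrow\pi$, $col'\Leftarrow col$, $\mu(j)\Leftarrow j$, $col'(j)\Leftarrow 1$, $a\Leftarrow j-1$, $q\Leftarrow\pi(j)$. While $\pi(a)\neq j$: if $q=a$ or $q>_a\pi(a)>_a j$, then put $\mu(a)\Leftarrow q$, put $col'(a)\Leftarrow -1$ if now $\mu(a)=a$, and put $q\Leftarrow\pi(a)$; in every case put $a\Leftarrow a-1$ (modulo $n$). When the loop ends, put $\mu(a)\Leftarrow q$, and $col'(a)\Leftarrow -1$ if now $\mu(a)=a$. 2. If $\pi(j)=j$ and $col(j)=+1$, then $\mathcal M'=\mathcal M_{\pi^{:}}$ and $\mu^{:}=\pi^{:}$.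 3. If $\pi(j)=j$ and $col(j)=-1$, then $\mathcal M'$ is empty, so that (by the convention) $\mu$ is the identity and $col'(i)=1$ for all $i\in[n]$. -/

import Mathlib

/-- A decorated permutation of `[n]`: a permutation together with a colouring of its fixed points
by the two colours `1` and `-1` (the elements of `ℤˣ`). The set `[n]` is modelled by `Fin n`. -/
@[ext]
structure DecoratedPerm (n : ℕ) where
  perm : Equiv.Perm (Fin n)
  col : {i : Fin n // perm i = i} → ℤˣ

/-- The strict cyclic order `a <_t b`, that is `t <_t t + 1 <_t ⋯ <_t t - 1`. Subtraction in
`Fin n` is modulo `n`, so `a - t` is the position of `a` counted clockwise from `t`. -/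
def CycLT {n : ℕ} (t a b : Fin n) : Prop := (a - t).val < (b - t).val

/-- The cyclic order `a ≤_t b`. -/
def CycLE {n : ℕ} (t a b : Fin n) : Prop := (a - t).val ≤ (b - t).val

instance {n : ℕ} (t a b : Fin n) : Decidable (CycLT t a b) :=
  inferInstanceAs (Decidable (_ < _))

instance {n : ℕ} (t a b : Fin n) : Decidable (CycLE t a b) :=
  inferInstanceAs (Decidable (_ ≤ _))

/-- The Gale order `A ≤_t B` on sets of the same size `k`: if `A = {f 0 <_t ⋯ <_t f (k-1)}` and
`B = {g 0 <_t ⋯ <_t g (k-1)}`, then `f i ≤_t g i` for every `i`. -/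
def GaleLE {n : ℕ} (t : Fin n) (A B : Finset (Fin n)) : Prop :=
  ∃ (k : ℕ) (f g : Fin k → Fin n),
    (∀ i i' : Fin k, i < i' → CycLT t (f i) (f i')) ∧
    (∀ i i' : Fin k, i < i' → CycLT t (g i) (g i')) ∧
    Finset.univ.image f = A ∧ Finset.univ.image g = B ∧
    ∀ i : Fin k, CycLE t (f i) (g i)

namespace DecoratedPerm

/-- The Grassmann necklace of a decorated permutation:
`I_r = {i | i <_r π⁻¹ i, or π i = i and col i = -1}`. -/
def necklace {n : ℕ} (p : DecoratedPerm n) (r : Fin n) : Set (Fin n) :=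
  {i | CycLT r i (p.perm.symm i) ∨ ∃ h : p.perm i = i, p.col ⟨i, h⟩ = -1}

open Classical in
/-- The positroid of a decorated permutation, as its family of bases:
`H` belongs to it iff `I_t ≤_t H` for every `t`. -/
noncomputable def positroid {n : ℕ} (p : DecoratedPerm n) : Set (Finset (Fin n)) :=
  {H | ∀ t : Fin n, GaleLE t (p.necklace t).toFinset H}

/-- The identity permutation with every fixed point coloured `1`. -/
def trivial (n : ℕ) : DecoratedPerm n := ⟨1, fun _ => 1⟩

/-- The colouring as a partial function on `[n]`, defined exactly at the fixed points. -/
def partialCol {n : ℕ} (p : DecoratedPerm n) (i : Fin n) : Option ℤˣ :=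
  if h : p.perm i = i then some (p.col ⟨i, h⟩) else none

end DecoratedPerm

/-- The deletion of `T` from a family of bases: the members that are disjoint from `T`. -/
def setDeletion {n : ℕ} (F : Set (Finset (Fin n))) (T : Set (Fin n)) : Set (Finset (Fin n)) :=
  {H | H ∈ F ∧ (H : Set (Fin n)) ⊆ Tᶜ}

/-- The restriction of a family of bases to `T`, still regarded as a family of subsets of `[n]`. -/
def setRestriction {n : ℕ} (F : Set (Finset (Fin n))) (T : Set (Fin n)) :
    Set (Finset (Fin n)) :=
  setDeletion F Tᶜ

/-- `m` is the decorated permutation of the family `F`: either `F` is the positroid of `m`, or `F`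
has no members at all (this is never the case for a positroid) and `m` is the trivial decorated
permutation, which is assigned to the empty family by convention. -/
def IsDecoratedPermOf {n : ℕ} (m : DecoratedPerm n) (F : Set (Finset (Fin n))) : Prop :=
  m.positroid = F ∨ (F = ∅ ∧ m = DecoratedPerm.trivial n)

namespace RestrictionAlg

/-- The variables of the restriction algorithm: the arrays `μ` and `col'` (a partial function),
the current position `a` and the carried value `q`. -/
structure State (n : ℕ) where
  mu : Fin n → Fin n
  col' : Fin n → Option ℤˣ
  a : Fin n
  q : Fin n

/-- The initialisation: `μ ⇐ π`, `col' ⇐ col`, `μ j ⇐ j`, `col' j ⇐ 1`, `a ⇐ j - 1`, `q ⇐ π j`. -/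
def init {n : ℕ} [NeZero n] (p : DecoratedPerm n) (j : Fin n) : State n where
  mu := Function.update p.perm j j
  col' := Function.update p.partialCol j (some 1)
  a := j - 1
  q := p.perm j

/-- The assignment `μ a ⇐ q`, followed by `col' a ⇐ -1` if now `μ a = a`. -/
def assign {n : ℕ} (s : State n) : State n where
  mu := Function.update s.mu s.a s.q
  col' := if s.q = s.a then Function.update s.col' s.a (some (-1)) else s.col'
  a := s.a
  q := s.q

/-- The body of the loop: if `q = a` or `q >_a π a >_a j`, then assign `q` to `μ a` and put
`q ⇐ π a`; in all cases `a ⇐ a - 1` (modulo `n`). -/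
def body {n : ℕ} [NeZero n] (p : DecoratedPerm n) (j : Fin n) (s : State n) : State n :=
  if s.q = s.a ∨ (CycLT s.a (p.perm s.a) s.q ∧ CycLT s.a j (p.perm s.a)) then
    { assign s with a := s.a - 1, q := p.perm s.a }
  else
    { s with a := s.a - 1 }

/-- `Loop p j s s'`: the loop `while π a ≠ j do body`, started in the state `s`, terminates in the
state `s'`. -/
inductive Loop {n : ℕ} [NeZero n] (p : DecoratedPerm n) (j : Fin n) : State n → State n → Prop
  | done (s : State n) (h : p.perm s.a = j) : Loop p j s s
  | step (s s' : State n) (h : p.perm s.a ≠ j) (hs : Loop p j (body p j s) s') : Loop p j s s'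

/-- On the input `p`, `j` the algorithm (initialisation, loop, final assignment `μ a ⇐ q`)
terminates and its output is the decorated permutation `m`. -/
def Outputs {n : ℕ} [NeZero n] (p : DecoratedPerm n) (j : Fin n) (m : DecoratedPerm n) : Prop :=
  ∃ s : State n, Loop p j (init p j) s ∧
    (assign s).mu = m.perm ∧ (assign s).col' = m.partialCol

end RestrictionAlg

/-! The decorated permutation is unrolled to a bounded affine permutation `f` of the integers
(`lift`), the colours `1` and `-1` of a fixed point becoming displacements `0` and `n`. Regard `m ↦
f m` as a chord from `m` to `f m`. The positions of `[t, x]` outside the necklace at `t` are the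
right ends of the chords contained in `[t, x]`. Hence (`mem_positroid_iff`) `H` is a basis iff it
has the right size and, in every window of length at most `n`, its count is at most the length minus
the number of chords inside. The necklace members are themselves bases, so these bounds are
attained; the positroid thus determines the chord counts and they determine `f`
(`positroid_injective`). This gives uniqueness.

Forbidding `J` changes the bounds only in windows that contain `J`. If a chord inside the window
passes over `J` (starts at or before it, ends at or after it), the bound stays. If none does, the
chords split into those left and those right of `J`, and the bound drops by one. A decorated
permutation with exactly these chord counts presents the deletion (`positroid_eq_setRestriction`).

The algorithm builds it by affine transpositions. Let `f z = J`. Initialisation exchanges the values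
at `z` and `J`; each assignment at position `A` exchanges those at `z` and `A`. Throughout, the
chord counts are those required if the only chords over `J` were the ones starting in `(A, J]` or at
`z`, and the carried value `F z` is the least right end of those starting in `(A, J]`. The chord
from `A` matters only if it ends after `J` and before `F z`, which is what the loop tests
(`body_condition_iff`). At `A = z` nothing is missing: a window containing a chord over `J` that
starts before `z` also contains the chord from `z` to `J`. -/

/-! ### Residues modulo `n`. -/

/-- The residue class of an integer, as an element of `Fin n`. -/
def residue (n : ℕ) [NeZero n] (m : ℤ) : Fin n :=
  ⟨(m % n).toNat, by
    have hn : (0 : ℤ) < n := by exact_mod_cast Nat.pos_of_ne_zero (NeZero.ne n)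
    have h1 := Int.emod_nonneg m hn.ne'
    have h2 := Int.emod_lt_of_pos m hn
    omega⟩

section Residue

variable {n : ℕ} [NeZero n]

theorem natCast_pos_int : (0 : ℤ) < n := by
  exact_mod_cast Nat.pos_of_ne_zero (NeZero.ne n)

theorem residue_val (m : ℤ) : ((residue n m).val : ℤ) = m % n :=
  Int.toNat_of_nonneg (Int.emod_nonneg m (natCast_pos_int (n := n)).ne')

theorem residue_eq_iff {a b : ℤ} : residue n a = residue n b ↔ (n : ℤ) ∣ a - b := by
  rw [← Fin.val_inj, ← Int.natCast_inj, residue_val, residue_val,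
    Int.emod_eq_emod_iff_emod_sub_eq_zero, Int.dvd_iff_emod_eq_zero]

theorem residue_natCast_val (i : Fin n) : residue n (i.val : ℤ) = i := by
  apply Fin.ext
  have := residue_val (n := n) (i.val : ℤ)
  rw [Int.emod_eq_of_lt (by omega) (by exact_mod_cast i.isLt)] at this
  exact_mod_cast this

theorem residue_surjective : Function.Surjective (residue n) :=
  fun i => ⟨_, residue_natCast_val i⟩

theorem residue_add_mul (m l : ℤ) : residue n (m + l * n) = residue n m := by
  rw [residue_eq_iff]; exact ⟨l, by ring⟩

theorem residue_add_self (m : ℤ) : residue n (m + n) = residue n m := by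
  rw [residue_eq_iff]; exact ⟨1, by ring⟩

theorem residue_sub_val (a b : ℤ) : ((residue n a - residue n b).val : ℤ) = (a - b) % n := by
  rw [Fin.sub_def]
  have hb : (residue n b).val ≤ n := (residue n b).isLt.le
  simp only [Int.natCast_emod, Nat.cast_add, Nat.cast_sub hb, residue_val]
  rw [Int.emod_eq_emod_iff_emod_sub_eq_zero, ← Int.dvd_iff_emod_eq_zero]
  have h1 := Int.mul_ediv_add_emod a n
  have h2 := Int.mul_ediv_add_emod b n
  exact ⟨1 - a / n + b / n, by linear_combination h1 - h2⟩

theorem residue_sub_one (a : ℤ) : residue n (a - 1) = residue n a - 1 := by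
  obtain ⟨i, rfl⟩ : ∃ i : ℤ, a = i + 1 := ⟨a - 1, by ring⟩
  rw [add_sub_cancel_right, eq_sub_iff_add_eq]
  apply Fin.ext
  have h : (1 : Fin n).val = 1 % n := rfl
  rw [Fin.val_add, h]
  zify
  rw [residue_val, residue_val]
  simp [Int.add_emod]

theorem residue_sub_val_of_mem {a b : ℤ} (h : b ≤ a) (h' : a < b + n) :
    ((residue n a - residue n b).val : ℤ) = a - b := by
  rw [residue_sub_val, Int.emod_eq_of_lt (by omega) (by omega)]

theorem residue_eq_iff_of_mem {a b : ℤ} (h : a < b + n) (h' : b < a + n) :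
    residue n a = residue n b ↔ a = b := by
  rw [residue_eq_iff]
  refine ⟨fun hd => ?_, fun e => by simp [e]⟩
  have := Int.eq_zero_of_abs_lt_dvd hd (abs_lt.2 ⟨by omega, by omega⟩)
  omega

theorem exists_residue_eq (i : Fin n) (t : ℤ) :
    ∃ m, t ≤ m ∧ m < t + n ∧ residue n m = i := by
  obtain ⟨a, rfl⟩ := residue_surjective i
  have hn := natCast_pos_int (n := n)
  refine ⟨t + (a - t) % n, by have := Int.emod_nonneg (a - t) hn.ne'; omega,
    by have := Int.emod_lt_of_pos (a - t) hn; omega, ?_⟩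
  rw [residue_eq_iff]
  have := Int.mul_ediv_add_emod (a - t) n
  exact ⟨-((a - t) / n), by linear_combination this⟩

end Residue

/-! ### Decorated permutations as bounded affine permutations. -/

/-- A bounded affine permutation of period `n`. -/
structure IsBoundedAffine (n : ℕ) (f : ℤ → ℤ) : Prop where
  bijective : Function.Bijective f
  map_add : ∀ m, f (m + n) = f m + n
  le : ∀ m, m ≤ f m
  le_add : ∀ m, f m ≤ m + n

theorem map_add_mul_of_map_add {n : ℕ} {f : ℤ → ℤ} (hf : ∀ m, f (m + n) = f m + n) (m l : ℤ) :
    f (m + l * n) = f m + l * n := by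
  induction l using Int.induction_on with
  | zero => simp
  | succ k ih => rw [show m + ((k : ℤ) + 1) * n = m + k * n + n by ring, hf, ih]; ring
  | pred k ih =>
    have := hf (m + (-(k : ℤ) - 1) * n)
    rw [show m + (-(k : ℤ) - 1) * n + n = m + -k * n by ring, ih] at this
    linear_combination -this

namespace DecoratedPerm

variable {n : ℕ} [NeZero n]

/-- The clockwise distance from `i` to its image, which is `0` at the fixed points of
colour `1` and `n` at those of colour `-1`. -/
def span {n : ℕ} (p : DecoratedPerm n) (i : Fin n) : ℤ :=
  if h : p.perm i = i then if p.col ⟨i, h⟩ = -1 then n else 0 else (p.perm i - i).val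

/-- The bounded affine permutation of a decorated permutation. -/
def lift (p : DecoratedPerm n) (m : ℤ) : ℤ := m + p.span (residue n m)

theorem span_nonneg {n : ℕ} (p : DecoratedPerm n) (i : Fin n) : 0 ≤ p.span i := by
  unfold span; split_ifs <;> omega

theorem span_le {n : ℕ} (p : DecoratedPerm n) (i : Fin n) : p.span i ≤ n := by
  unfold span; split_ifs <;> omega

theorem residue_lift (p : DecoratedPerm n) (m : ℤ) :
    residue n (p.lift m) = p.perm (residue n m) := by
  unfold lift span
  split_ifs with h h'
  · rw [residue_add_self, h]
  · rw [add_zero, h]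
  · obtain ⟨b, hb⟩ := residue_surjective (p.perm (residue n m))
    rw [← hb, residue_sub_val, residue_eq_iff]
    have := Int.mul_ediv_add_emod (b - m) n
    exact ⟨-((b - m) / n), by linear_combination this⟩

theorem lift_eq_self_iff (p : DecoratedPerm n) (m : ℤ) :
    p.lift m = m ↔ ∃ h : p.perm (residue n m) = residue n m, p.col ⟨_, h⟩ ≠ -1 := by
  have hn := natCast_pos_int (n := n)
  constructor
  · intro h
    have h1 : p.perm (residue n m) = residue n m := by rw [← residue_lift, h]
    refine ⟨h1, fun hc => ?_⟩
    simp only [lift, span, h1, hc, dite_true, if_true] at h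
    omega
  · rintro ⟨h, hc⟩
    simp [lift, span, h, hc]

theorem lift_eq_add_iff (p : DecoratedPerm n) (m : ℤ) :
    p.lift m = m + n ↔ ∃ h : p.perm (residue n m) = residue n m, p.col ⟨_, h⟩ = -1 := by
  have hn := natCast_pos_int (n := n)
  constructor
  · intro h
    have h1 : p.perm (residue n m) = residue n m := by rw [← residue_lift, h, residue_add_self]
    refine ⟨h1, ?_⟩
    by_contra hc
    simp only [lift, span, h1, hc, dite_true, if_false] at h
    omega
  · rintro ⟨h, hc⟩
    simp [lift, span, h, hc]

theorem isBoundedAffine_lift (p : DecoratedPerm n) : IsBoundedAffine n p.lift where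
  bijective := by
    constructor
    · intro a b h
      have : residue n a = residue n b := by
        apply p.perm.injective; rw [← residue_lift, ← residue_lift, h]
      unfold lift at h
      rw [this] at h
      omega
    · intro v
      obtain ⟨i, hi⟩ := residue_surjective (p.perm.symm (residue n v))
      have h1 : residue n (p.lift i) = residue n v := by rw [residue_lift, hi]; simp
      rw [residue_eq_iff] at h1
      have h2 : residue n (v - p.span (residue n i)) = residue n i := by
        obtain ⟨l, hl⟩ := h1
        rw [DecoratedPerm.lift] at hl
        exact residue_eq_iff.2 ⟨-l, by linear_combination -hl⟩
      exact ⟨v - p.span (residue n i), by rw [DecoratedPerm.lift, h2]; ring⟩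
  map_add m := by unfold lift; rw [residue_add_self]; ring
  le m := by have := p.span_nonneg (residue n m); unfold lift; omega
  le_add m := by have := p.span_le (residue n m); unfold lift; omega

theorem lift_injective : Function.Injective (lift : DecoratedPerm n → ℤ → ℤ) := by
  intro p q h
  have hp : p.perm = q.perm := by
    ext i : 1
    obtain ⟨m, rfl⟩ := residue_surjective i
    rw [← residue_lift, ← residue_lift, h]
  obtain ⟨π, c⟩ := p
  obtain ⟨π', c'⟩ := q
  obtain rfl : π = π' := hp
  congr
  ext1 ⟨i, hi⟩
  obtain ⟨m, rfl⟩ := residue_surjective i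
  have h1 := lift_eq_add_iff ⟨π, c⟩ m
  have h2 := lift_eq_add_iff ⟨π, c'⟩ m
  rw [h, h2] at h1
  simp only [hi, exists_true_left] at h1
  rcases Int.units_eq_one_or (c ⟨_, hi⟩) with e | e <;>
    rcases Int.units_eq_one_or (c' ⟨_, hi⟩) with e' | e' <;> simp_all

/-- This turns the integer map built by the algorithm back into a decorated permutation; the colour
records whether a fixed residue is displaced by `n` or by `0`. -/
theorem exists_lift_eq {f : ℤ → ℤ} (hf : IsBoundedAffine n f) :
    ∃ p : DecoratedPerm n, p.lift = f := by
  have hn := natCast_pos_int (n := n)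
  have hres : ∀ a b, residue n a = residue n b ↔ residue n (f a) = residue n (f b) := by
    intro a b
    rw [residue_eq_iff, residue_eq_iff]
    constructor
    · rintro ⟨l, hl⟩
      obtain rfl : a = b + l * n := by linear_combination hl
      exact ⟨l, by rw [map_add_mul_of_map_add hf.map_add]; ring⟩
    · rintro ⟨l, hl⟩
      have : f a = f (b + l * n) := by
        rw [map_add_mul_of_map_add hf.map_add]; linear_combination hl
      exact ⟨l, by rw [hf.bijective.1 this]; ring⟩
  let g : Fin n → Fin n := fun i => residue n (f i.val)
  have hg : ∀ m, g (residue n m) = residue n (f m) := fun m =>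
    (hres _ _).1 (residue_natCast_val _)
  have hinj : Function.Injective g := by
    intro i i' h
    have := (hres _ _).2 h
    rwa [residue_natCast_val, residue_natCast_val] at this
  let e : Equiv.Perm (Fin n) := Equiv.ofBijective g (Finite.injective_iff_bijective.1 hinj)
  have he : ∀ m, e (residue n m) = residue n (f m) := hg
  have hfn : ∀ a b, residue n a = residue n b → f a - a = f b - b := by
    intro a b h
    obtain ⟨l, hl⟩ := residue_eq_iff.1 h
    obtain rfl : a = b + l * n := by linear_combination hl
    rw [map_add_mul_of_map_add hf.map_add]; ring
  refine ⟨⟨e, fun i => if f i.1.val = i.1.val + n then -1 else 1⟩, ?_⟩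
  ext m
  have h0 := hf.le m
  have h1 := hf.le_add m
  have h3 := hfn _ _ (residue_natCast_val (residue n m))
  unfold lift span
  simp only [he]
  split_ifs with h h' hc hc
  · omega
  · exact absurd rfl hc
  · exact absurd hc (by decide)
  · by_contra hne
    rw [residue_eq_iff_of_mem (by omega) (by omega)] at h
    omega
  · have : f m ≠ m + n := fun e => h (by rw [e, residue_add_self])
    rw [residue_sub_val_of_mem (by omega) (by omega)]
    ring

end DecoratedPerm

/-! ### Counting functions and the Gale order. -/

/-- The number of chords `m ↦ f m` that lie in the interval `[t, x]`. -/
noncomputable def chordCount (f : ℤ → ℤ) (t x : ℤ) : ℤ := ((Finset.Icc t x).filter (fun m => f m ≤ x)).card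

/-- The number of integers in `[t, x]` whose residue class belongs to `H`. -/
noncomputable def windowCount {n : ℕ} [NeZero n] (H : Finset (Fin n)) (t x : ℤ) : ℤ :=
  ((Finset.Icc t x).filter (fun m => residue n m ∈ H)).card

section Gale

theorem card_filter_image_of_cycLT {n k : ℕ} {t : Fin n} {f : Fin k → Fin n}
    (hf : ∀ i i' : Fin k, i < i' → CycLT t (f i) (f i')) (P : Fin n → Prop) [DecidablePred P] :
    ((Finset.univ.image f).filter P).card = (Finset.univ.filter (fun i => P (f i))).card := by
  have hinj : Function.Injective f := by
    intro i i' h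
    rcases lt_trichotomy i i' with hl | hl | hl
    · have := hf _ _ hl; rw [h] at this; exact absurd this (lt_irrefl _)
    · exact hl
    · have := hf _ _ hl; rw [h] at this; exact absurd this (lt_irrefl _)
  rw [Finset.filter_image, Finset.card_image_of_injective _ hinj]

theorem exists_cyclic_enumeration {n : ℕ} [NeZero n] (t : Fin n) (A : Finset (Fin n)) {k : ℕ}
    (hk : A.card = k) : ∃ f : Fin k → Fin n,
      (∀ i i' : Fin k, i < i' → CycLT t (f i) (f i')) ∧ Finset.univ.image f = A := by
  have hc : (A.image (· - t)).card = k := by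
    rw [Finset.card_image_of_injective _ (sub_left_injective), hk]
  refine ⟨fun i => (A.image (· - t)).orderEmbOfFin hc i + t, fun i i' h => ?_, ?_⟩
  · unfold CycLT
    rw [add_sub_cancel_right, add_sub_cancel_right]
    exact ((A.image (· - t)).orderEmbOfFin hc).lt_iff_lt.2 h
  · have h1 := Finset.image_orderEmbOfFin_univ (A.image (· - t)) hc
    have h2 : (Finset.univ.image fun i => (A.image (· - t)).orderEmbOfFin hc i + t)
        = (Finset.univ.image ((A.image (· - t)).orderEmbOfFin hc)).image (· + t) := by
      rw [Finset.image_image]; rfl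
    rw [h2, h1, Finset.image_image]
    simp [Function.comp_def]

/-- Comparing sorted lists entrywise amounts to comparing how many entries lie in each initial
segment. This removes the enumerations from all later arguments. -/
theorem galeLE_iff_card {n : ℕ} [NeZero n] (t : Fin n) (A B : Finset (Fin n)) :
    GaleLE t A B ↔ A.card = B.card ∧
      ∀ c : ℕ, (B.filter (fun b => (b - t).val < c)).card ≤
        (A.filter (fun a => (a - t).val < c)).card := by
  constructor
  · rintro ⟨k, f, g, hf, hg, rfl, rfl, h⟩
    constructor
    · have h1 := card_filter_image_of_cycLT hf (fun _ => True)
      have h2 := card_filter_image_of_cycLT hg (fun _ => True)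
      simp only [Finset.filter_true] at h1 h2
      rw [h1, h2]
    · intro c
      rw [card_filter_image_of_cycLT hf, card_filter_image_of_cycLT hg]
      exact Finset.card_le_card fun i hi => by
        simp only [Finset.mem_filter, Finset.mem_univ, true_and] at hi ⊢
        exact lt_of_le_of_lt (h i) hi
  · rintro ⟨hc, h⟩
    obtain ⟨k, hk⟩ : ∃ k, B.card = k := ⟨_, rfl⟩
    obtain ⟨f, hf, hfA⟩ := exists_cyclic_enumeration t A (hc.trans hk)
    obtain ⟨g, hg, hgB⟩ := exists_cyclic_enumeration t B hk
    refine ⟨_, f, g, hf, hg, hfA, hgB, fun i => ?_⟩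
    by_contra hlt
    unfold CycLE at hlt
    -- Cut just after `g i`: at least `i + 1` elements of `B` lie below the cut, but at most `i`
    -- elements of `A`.
    have h1 := h ((g i - t).val + 1)
    rw [← hfA, ← hgB, card_filter_image_of_cycLT hf, card_filter_image_of_cycLT hg] at h1
    have h2 : (Finset.univ.filter fun i' => (f i' - t).val < (g i - t).val + 1) ⊆
        Finset.Iio i := by
      intro i' hi'
      simp only [Finset.mem_filter, Finset.mem_univ, true_and, Finset.mem_Iio] at hi' ⊢
      by_contra hle
      rcases (not_lt.1 hle).eq_or_lt with e | e
      · subst e; omega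
      · have := hf _ _ e; unfold CycLT at this; omega
    have h3 : Finset.Iic i ⊆
        (Finset.univ.filter fun i' => (g i' - t).val < (g i - t).val + 1) := by
      intro i' hi'
      simp only [Finset.mem_filter, Finset.mem_univ, true_and, Finset.mem_Iic] at hi' ⊢
      rcases hi'.eq_or_lt with e | e
      · subst e; omega
      · have := hg _ _ e; unfold CycLT at this; omega
    have h4 := Finset.card_le_card h2
    have h5 := Finset.card_le_card h3
    rw [Fin.card_Iio] at h4
    rw [Fin.card_Iic] at h5
    omega

end Gale

/-! ### Windows of integers and the Gale order. -/

section Window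

variable {n : ℕ} [NeZero n]

theorem windowCount_eq_card (H : Finset (Fin n)) {t x : ℤ} (hx : x < t + n) :
    windowCount H t x = (H.filter (fun h => (((h - residue n t).val : ℕ) : ℤ) < x + 1 - t)).card := by
  unfold windowCount
  congr 1
  refine Finset.card_bij (fun m _ => residue n m) ?_ ?_ ?_
  · intro m hm
    simp only [Finset.mem_filter, Finset.mem_Icc] at hm ⊢
    refine ⟨hm.2, ?_⟩
    rw [residue_sub_val_of_mem (by omega) (by omega)]; omega
  · intro m hm m' hm' h
    simp only [Finset.mem_filter, Finset.mem_Icc] at hm hm'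
    exact (residue_eq_iff_of_mem (by omega) (by omega)).1 h
  · intro h hh
    obtain ⟨m, h1, h2, rfl⟩ := exists_residue_eq h t
    simp only [Finset.mem_filter, Finset.mem_Icc] at hh ⊢
    rw [residue_sub_val_of_mem h1 h2] at hh
    exact ⟨m, ⟨⟨h1, by omega⟩, hh.1⟩, rfl⟩

theorem windowCount_full (H : Finset (Fin n)) (t : ℤ) :
    windowCount H t (t + n - 1) = H.card := by
  rw [windowCount_eq_card H (by omega), Finset.filter_true_of_mem]
  intro h _
  have := (h - residue n t).isLt
  omega

theorem windowCount_add_mul (H : Finset (Fin n)) (t x l : ℤ) :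
    windowCount H (t + l * n) (x + l * n) = windowCount H t x := by
  unfold windowCount
  congr 1
  symm
  refine Finset.card_bij (fun m _ => m + l * n) ?_ (fun _ _ _ _ h => by simpa using h) ?_
  · intro m hm
    simp only [Finset.mem_filter, Finset.mem_Icc, residue_add_mul] at hm ⊢
    exact ⟨by omega, hm.2⟩
  · intro m hm
    simp only [Finset.mem_filter, Finset.mem_Icc] at hm ⊢
    refine ⟨m - l * n, ⟨by omega, ?_⟩, by ring⟩
    rw [← residue_add_mul (m - l * n) l, sub_add_cancel]; exact hm.2

theorem windowCount_split (H : Finset (Fin n)) {t e x : ℤ} (h1 : t ≤ e) (h2 : e ≤ x + 1) :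
    windowCount H t x = windowCount H t (e - 1) + windowCount H e x := by
  unfold windowCount
  rw [← Nat.cast_add, ← Finset.card_union_of_disjoint]
  · congr 2
    ext m
    simp only [Finset.mem_filter, Finset.mem_Icc, Finset.mem_union]
    constructor
    · rintro ⟨⟨a, b⟩, c⟩
      by_cases h : m < e
      · exact Or.inl ⟨⟨a, by omega⟩, c⟩
      · exact Or.inr ⟨⟨by omega, b⟩, c⟩
    · rintro (⟨⟨a, b⟩, c⟩ | ⟨⟨a, b⟩, c⟩)
      · exact ⟨⟨a, by omega⟩, c⟩
      · exact ⟨⟨by omega, b⟩, c⟩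
  · rw [Finset.disjoint_left]
    intro m hm hm'
    simp only [Finset.mem_filter, Finset.mem_Icc] at hm hm'
    omega

theorem galeLE_iff_windowCount (t : ℤ) (A B : Finset (Fin n)) :
    GaleLE (residue n t) A B ↔ A.card = B.card ∧
      ∀ x, t ≤ x + 1 → x < t + n → windowCount B t x ≤ windowCount A t x := by
  rw [galeLE_iff_card]
  refine and_congr_right fun _ => ⟨fun h x hx hx' => ?_, fun h c => ?_⟩
  · rw [windowCount_eq_card _ hx', windowCount_eq_card _ hx']
    have := h (x + 1 - t).toNat
    zify at this
    simpa only [Int.toNat_of_nonneg (show 0 ≤ x + 1 - t by omega), Int.ofNat_lt,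
      Nat.cast_le, Nat.cast_lt, Int.lt_toNat] using this
  · have h1 := h (t + min c n - 1) (by omega) (by omega)
    rw [windowCount_eq_card _ (by omega), windowCount_eq_card _ (by omega)] at h1
    have key : ∀ H : Finset (Fin n),
        (H.filter fun h => (((h - residue n t).val : ℕ) : ℤ) < t + min c n - 1 + 1 - t) =
          H.filter fun h => (h - residue n t).val < c := by
      intro H
      refine Finset.filter_congr fun h _ => ?_
      have := (h - residue n t).isLt
      omega
    rw [key, key] at h1
    exact_mod_cast h1

end Window

/-! ### Chord counts of bounded affine permutations. -/

section Chord

variable {n : ℕ} [NeZero n] {f : ℤ → ℤ}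

theorem chordCount_nonneg (f : ℤ → ℤ) (t x : ℤ) : 0 ≤ chordCount f t x := Nat.cast_nonneg _

omit [NeZero n] in
theorem chordCount_add_mul (hf : IsBoundedAffine n f) (t x l : ℤ) :
    chordCount f (t + l * n) (x + l * n) = chordCount f t x := by
  unfold chordCount
  congr 1
  symm
  refine Finset.card_bij (fun m _ => m + l * n) ?_ (fun _ _ _ _ h => by simpa using h) ?_
  · intro m hm
    simp only [Finset.mem_filter, Finset.mem_Icc, map_add_mul_of_map_add hf.map_add] at hm ⊢
    omega
  · intro m hm
    simp only [Finset.mem_filter, Finset.mem_Icc] at hm ⊢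
    refine ⟨m - l * n, ⟨by omega, ?_⟩, by ring⟩
    have := map_add_mul_of_map_add hf.map_add (m - l * n) l
    rw [sub_add_cancel] at this
    omega

/-- A chord contained in `[t, x]` or in `[e, y]` is contained in `[t, y]`; one contained in both is
contained in `[e, x]`. -/
theorem chordCount_supermodular (f : ℤ → ℤ) {t e x y : ℤ} (hte : t ≤ e) (hxy : x ≤ y) :
    chordCount f t x + chordCount f e y ≤ chordCount f e x + chordCount f t y := by
  unfold chordCount
  norm_cast
  rw [← Finset.card_union_add_card_inter, add_comm]
  refine add_le_add (Finset.card_le_card fun m hm => ?_) (Finset.card_le_card fun m hm => ?_)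
  · simp only [Finset.mem_inter, Finset.mem_filter, Finset.mem_Icc] at hm ⊢
    omega
  · simp only [Finset.mem_union, Finset.mem_filter, Finset.mem_Icc] at hm ⊢
    omega

theorem chordCount_split (hf : ∀ m, m ≤ f m) {t J x : ℤ} (ht : t ≤ J) (hx : J ≤ x)
    (h : ∀ m, t ≤ m → m ≤ J → J ≤ f m → ¬ f m ≤ x) :
    chordCount f t x = chordCount f t (J - 1) + chordCount f (J + 1) x := by
  unfold chordCount
  rw [← Nat.cast_add, ← Finset.card_union_of_disjoint]
  · congr 2
    ext m
    simp only [Finset.mem_filter, Finset.mem_Icc, Finset.mem_union]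
    have := h m
    have := hf m
    omega
  · rw [Finset.disjoint_left]
    intro m hm hm'
    simp only [Finset.mem_filter, Finset.mem_Icc] at hm hm'
    omega

theorem chordCount_sub_succ (f : ℤ → ℤ) {t x : ℤ} (h : t ≤ x) :
    chordCount f t x = chordCount f (t + 1) x + if f t ≤ x then 1 else 0 := by
  unfold chordCount
  have : Finset.Icc t x = insert t (Finset.Icc (t + 1) x) := by
    ext m; simp only [Finset.mem_Icc, Finset.mem_insert]; omega
  rw [this, Finset.filter_insert]
  split_ifs with h1
  · rw [Finset.card_insert_of_notMem (by simp)]; push_cast; ring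
  · simp

omit [NeZero n] in
theorem chordCount_succ_right (hf : IsBoundedAffine n f) {t x m : ℤ} (hm : f m = x + 1) :
    chordCount f t (x + 1) = chordCount f t x + if t ≤ m then 1 else 0 := by
  unfold chordCount
  have hle := hf.le
  split_ifs with h1
  · have : (Finset.Icc t (x + 1)).filter (fun m => f m ≤ x + 1) =
        insert m ((Finset.Icc t x).filter (fun m => f m ≤ x)) := by
      ext m'
      simp only [Finset.mem_Icc, Finset.mem_insert, Finset.mem_filter]
      have := hle m'
      have h2 := hle m
      by_cases e : m' = m
      · subst e; simp; omega
      · have : f m' ≠ x + 1 := fun h => e (hf.bijective.1 (h.trans hm.symm))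
        omega
    rw [this, Finset.card_insert_of_notMem (by simp; omega)]; push_cast; ring
  · rw [add_zero]
    congr 2
    ext m'
    simp only [Finset.mem_Icc, Finset.mem_filter]
    have := hle m'
    have : t ≤ m' → f m' ≠ x + 1 := fun h h' => by
      rw [hf.bijective.1 (h'.trans hm.symm)] at h; omega
    omega

/-- Sliding the window loses the chord leaving `t` and gains the one arriving at `t + n`. If these
coincide, that chord has length `n` and fits in neither window. -/
theorem chordCount_window_succ (hf : IsBoundedAffine n f) (t : ℤ) :
    chordCount f (t + 1) (t + 1 + n - 1) = chordCount f t (t + n - 1) := by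
  have hn := natCast_pos_int (n := n)
  obtain ⟨m, hm⟩ := hf.bijective.2 (t + n)
  have h1 := chordCount_sub_succ f (t := t) (x := t + n - 1) (by omega)
  have h2 := chordCount_succ_right hf (t := t + 1) (x := t + n - 1) (m := m) (by omega)
  have h3 := hf.le_add t
  have h4 := hf.le_add m
  have h5 : f t = t + n ↔ m = t :=
    ⟨fun h => hf.bijective.1 (hm.trans h.symm), fun h => h ▸ hm⟩
  rw [show t + n - 1 + 1 = t + 1 + (n : ℤ) - 1 by ring] at h2
  rw [h1, h2]
  split_ifs <;> omega

theorem chordCount_window (hf : IsBoundedAffine n f) (t t' : ℤ) :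
    chordCount f t (t + n - 1) = chordCount f t' (t' + n - 1) := by
  have key : ∀ l : ℤ, chordCount f (t' + l) (t' + l + n - 1) = chordCount f t' (t' + n - 1) := by
    intro l
    induction l using Int.induction_on with
    | zero => simp
    | succ k ih => rw [← ih, ← chordCount_window_succ hf (t' + k)]; ring_nf
    | pred k ih => rw [← ih, ← chordCount_window_succ hf (t' + (-k - 1))]; ring_nf
  have := key (t - t')
  rwa [add_sub_cancel] at this

omit [NeZero n] in
-- Differencing in the left end reveals whether `f m ≤ x` for every `x` in `[m, m + n)`; if this
-- always fails, boundedness leaves only `f m = m + n`.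
theorem eq_of_chordCount_eq {g : ℤ → ℤ} (hf : IsBoundedAffine n f) (hg : IsBoundedAffine n g)
    (h : ∀ t x : ℤ, t ≤ x + 1 → x < t + n → chordCount f t x = chordCount g t x) : f = g := by
  have key : ∀ m x : ℤ, m ≤ x → x < m + n → (f m ≤ x ↔ g m ≤ x) := by
    intro m x h1 h2
    have e1 := chordCount_sub_succ f h1
    have e2 := chordCount_sub_succ g h1
    have e3 := h m x (by omega) h2
    have e4 := h (m + 1) x (by omega) (by omega)
    split_ifs at e1 e2 <;> omega
  ext m
  have h1 := hf.le m
  have h2 := hf.le_add m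
  have h3 := hg.le m
  have h4 := hg.le_add m
  rcases lt_trichotomy (f m) (g m) with hl | hl | hl
  · have := key m (f m) h1 (by omega); omega
  · exact hl
  · have := key m (g m) h3 (by omega); omega

end Chord

/-! ### Positroids through interval bounds, and uniqueness. -/

namespace DecoratedPerm

variable {n : ℕ} [NeZero n]

/-- Both clauses of the necklace merge into one: the chord arriving at `m` starts before `t`. A
fixed point of colour `-1` satisfies this because its chord starts at `m - n`. -/
theorem residue_mem_necklace_iff (p : DecoratedPerm n) {t m m' : ℤ} (ht : t ≤ m)
    (ht' : m < t + n) (hm : p.lift m' = m) :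
    residue n m ∈ p.necklace (residue n t) ↔ m' < t := by
  have hf := p.isBoundedAffine_lift
  have h1 := hf.le m'
  have h2 := hf.le_add m'
  have hr : residue n m = p.perm (residue n m') := by rw [← residue_lift, hm]
  have hs : p.perm.symm (residue n m) = residue n m' := by rw [hr, Equiv.symm_apply_apply]
  have hl : CycLT (residue n t) (residue n m) (p.perm.symm (residue n m)) ↔
      m - t < (m' - t) % n := by
    rw [hs, ← residue_sub_val, ← residue_sub_val_of_mem ht ht']
    exact Int.ofNat_lt.symm
  have hcol : (∃ h : p.perm (residue n m) = residue n m, p.col ⟨_, h⟩ = -1) ↔ m = m' + n := by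
    rw [← lift_eq_add_iff]
    constructor
    · intro h
      have : p.lift (m' + n) = p.lift m := by rw [hf.map_add, h, hm]
      exact (hf.bijective.1 this).symm
    · intro h
      conv_lhs => rw [h, hf.map_add, hm]
  change _ ∨ _ ↔ _
  rw [hl, hcol]
  by_cases h : m' < t
  · have : (m' - t) % n = m' - t + n := by
      rw [← Int.add_emod_right, Int.emod_eq_of_lt (by omega) (by omega)]
    omega
  · rw [Int.emod_eq_of_lt (by omega) (by omega)]
    omega

open Classical in
/-- The Grassmann necklace as a family of finite sets, indexed by the integers. -/
noncomputable def necklaceFinset (p : DecoratedPerm n) (t : ℤ) : Finset (Fin n) :=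
  (p.necklace (residue n t)).toFinset

theorem residue_mem_necklaceFinset_iff (p : DecoratedPerm n) {t m m' : ℤ} (ht : t ≤ m)
    (ht' : m < t + n) (hm : p.lift m' = m) :
    residue n m ∈ p.necklaceFinset t ↔ m' < t := by
  classical
  rw [← residue_mem_necklace_iff p ht ht' hm, necklaceFinset, Set.mem_toFinset]

theorem mem_positroid_iff_galeLE (p : DecoratedPerm n) (H : Finset (Fin n)) :
    H ∈ p.positroid ↔ ∀ t : ℤ, GaleLE (residue n t) (p.necklaceFinset t) H :=
  ⟨fun h t => h (residue n t), fun h t => by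
    obtain ⟨m, rfl⟩ := residue_surjective t
    exact h m⟩

theorem windowCount_necklaceFinset (p : DecoratedPerm n) {t x : ℤ} (h : t ≤ x + 1)
    (hx : x < t + n) :
    windowCount (p.necklaceFinset t) t x = x + 1 - t - chordCount p.lift t x := by
  classical
  have hf := p.isBoundedAffine_lift
  have h1 : (((Finset.Icc t x).filter (fun m => ¬ residue n m ∈ p.necklaceFinset t)).card : ℤ) =
      chordCount p.lift t x := by
    unfold chordCount
    congr 1
    symm
    refine Finset.card_bij (fun m _ => p.lift m) ?_ (fun _ _ _ _ e => hf.bijective.1 e) ?_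
    · intro m hm
      simp only [Finset.mem_filter, Finset.mem_Icc] at hm ⊢
      have := hf.le m
      rw [residue_mem_necklaceFinset_iff p (m' := m) (by omega) (by omega) rfl]
      omega
    · intro v hv
      simp only [Finset.mem_filter, Finset.mem_Icc] at hv ⊢
      obtain ⟨m, hm⟩ := hf.bijective.2 v
      rw [residue_mem_necklaceFinset_iff p (by omega) (by omega) hm] at hv
      have := hf.le m
      exact ⟨m, ⟨by omega, by omega⟩, hm⟩
  have h2 := Finset.card_filter_add_card_filter_not (s := Finset.Icc t x)
    (fun m => residue n m ∈ p.necklaceFinset t)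
  rw [Int.card_Icc] at h2
  unfold windowCount
  omega

theorem card_necklaceFinset (p : DecoratedPerm n) (t : ℤ) :
    ((p.necklaceFinset t).card : ℤ) = n - chordCount p.lift t (t + n - 1) := by
  have hn := natCast_pos_int (n := n)
  rw [← windowCount_full _ t, windowCount_necklaceFinset p (by omega) (by omega)]
  ring

theorem mem_positroid_iff (p : DecoratedPerm n) (H : Finset (Fin n)) :
    H ∈ p.positroid ↔ (∀ t, (H.card : ℤ) = n - chordCount p.lift t (t + n - 1)) ∧
      ∀ t x : ℤ, t ≤ x + 1 → x < t + n →
        windowCount H t x ≤ x + 1 - t - chordCount p.lift t x := by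
  rw [mem_positroid_iff_galeLE]
  simp only [galeLE_iff_windowCount]
  rw [forall_and]
  refine and_congr (forall_congr' fun t => ?_) (forall_congr' fun t => forall_congr' fun x =>
    forall_congr' fun h => forall_congr' fun hx => ?_)
  · rw [← card_necklaceFinset, Nat.cast_inj, eq_comm]
  · rw [windowCount_necklaceFinset p h hx]

/-- On windows starting at `r` the count is exact, so counts elsewhere are differences of exact ones
and the required inequality is supermodularity of the chord count. -/
theorem necklaceFinset_mem_positroid (p : DecoratedPerm n) (r : ℤ) :
    p.necklaceFinset r ∈ p.positroid := by
  have hf := p.isBoundedAffine_lift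
  rw [mem_positroid_iff]
  refine ⟨fun t => by rw [card_necklaceFinset, chordCount_window hf], fun t x h hx => ?_⟩
  have hn := natCast_pos_int (n := n)
  have key : ∀ t x : ℤ, r ≤ t → t < r + n → t ≤ x + 1 → x < t + n →
      windowCount (p.necklaceFinset r) t x ≤ x + 1 - t - chordCount p.lift t x := by
    intro t x hrt htr h hx
    have hleft : windowCount (p.necklaceFinset r) r (t - 1) =
        t - r - chordCount p.lift r (t - 1) := by
      rw [windowCount_necklaceFinset p (by omega) (by omega)]; ring
    by_cases hxr : x < r + n
    · have h1 := windowCount_split (p.necklaceFinset r) hrt h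
      rw [windowCount_necklaceFinset p (by omega) (by omega), hleft] at h1
      have h2 := chordCount_supermodular p.lift (t := r) (e := t) (x := t - 1) (y := x) hrt
        (by omega)
      have h3 := chordCount_nonneg p.lift t (t - 1)
      have h4 : windowCount (p.necklaceFinset r) t x ≤ x + 1 - t - chordCount p.lift t x ↔
          chordCount p.lift r (t - 1) + chordCount p.lift t x ≤ chordCount p.lift r x := by
        omega
      rw [h4]
      have h5 : chordCount p.lift t (t - 1) = 0 := by
        unfold chordCount; rw [Finset.Icc_eq_empty (by omega)]; rfl
      omega
    -- The window wraps past `r + n`: the count is the total, less the part in `[r, t - 1]`, plus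
    -- the part in `[r + n, x]`, which is exact after a shift by one period.
    · have h1 := windowCount_split (p.necklaceFinset r) (t := t) (e := r + n) (x := x) (by omega)
        (by omega)
      have h2 := windowCount_split (p.necklaceFinset r) (t := r) (e := t) (x := r + n - 1) hrt
        (by omega)
      rw [windowCount_full, card_necklaceFinset, hleft] at h2
      have h3 := windowCount_add_mul (p.necklaceFinset r) r (x - n) 1
      rw [one_mul, sub_add_cancel, windowCount_necklaceFinset p (by omega) (by omega)] at h3
      have h4 := chordCount_add_mul hf r (x - n) 1
      rw [one_mul, sub_add_cancel] at h4
      have h5 := chordCount_add_mul hf r (t - 1) 1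
      rw [one_mul, show t - 1 + (n : ℤ) = t + n - 1 by ring] at h5
      have h6 := chordCount_window hf r t
      have h7 := chordCount_supermodular p.lift (t := t) (e := r + n) (x := x) (y := t + n - 1)
        (by omega) (by omega)
      omega
  have h1 := Int.mul_ediv_add_emod (t - r) n
  have h2 := Int.emod_nonneg (t - r) hn.ne'
  have h3 := Int.emod_lt_of_pos (t - r) hn
  have h4 : t = r + (t - r) % n + (t - r) / n * n := by linear_combination -h1
  have h5 := key (t - (t - r) / n * n) (x - (t - r) / n * n) (by omega) (by omega) (by omega)
    (by omega)
  rw [← windowCount_add_mul _ _ _ ((t - r) / n), ← chordCount_add_mul hf _ _ ((t - r) / n),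
    sub_add_cancel, sub_add_cancel] at h5
  omega

theorem positroid_nonempty (p : DecoratedPerm n) : p.positroid.Nonempty :=
  ⟨_, p.necklaceFinset_mem_positroid 0⟩

/-- Testing the necklace member at `t`, a basis of both, against the bound of the other permutation
on `[t, x]` gives one inequality of chord counts; symmetry gives the other. -/
theorem positroid_injective :
    Function.Injective (positroid : DecoratedPerm n → Set (Finset (Fin n))) := by
  have key : ∀ p q : DecoratedPerm n, p.positroid = q.positroid → ∀ t x : ℤ, t ≤ x + 1 →
      x < t + n → chordCount q.lift t x ≤ chordCount p.lift t x := by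
    intro p q h t x h1 h2
    have h3 := p.necklaceFinset_mem_positroid t
    rw [h, mem_positroid_iff] at h3
    have h4 := h3.2 t x h1 h2
    rw [windowCount_necklaceFinset p h1 h2] at h4
    omega
  intro p q h
  exact lift_injective (eq_of_chordCount_eq p.isBoundedAffine_lift q.isBoundedAffine_lift
    fun t x h1 h2 => le_antisymm (key q p h.symm t x h1 h2) (key p q h t x h1 h2))

theorem isDecoratedPermOf_positroid_iff (p q : DecoratedPerm n) :
    IsDecoratedPermOf q p.positroid ↔ q = p := by
  refine ⟨?_, fun h => Or.inl (by rw [h])⟩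
  rintro (h | ⟨h, -⟩)
  · exact positroid_injective h
  · exact absurd h p.positroid_nonempty.ne_empty

theorem isDecoratedPermOf_empty_iff (q : DecoratedPerm n) :
    IsDecoratedPermOf q ∅ ↔ q = trivial n := by
  refine ⟨?_, fun h => Or.inr ⟨rfl, h⟩⟩
  rintro (h | ⟨-, h⟩)
  · exact absurd h q.positroid_nonempty.ne_empty
  · exact h

end DecoratedPerm

/-! ### Deletion of one element in terms of chord counts. -/

section Deletion

variable {n : ℕ} [NeZero n]

omit [NeZero n] in
theorem mem_setRestriction_compl_singleton {F : Set (Finset (Fin n))} {j : Fin n}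
    {H : Finset (Fin n)} : H ∈ setRestriction F {j}ᶜ ↔ H ∈ F ∧ j ∉ H := by
  unfold setRestriction setDeletion
  refine and_congr_right fun _ => ?_
  rw [compl_compl, Set.subset_compl_singleton_iff, Finset.mem_coe]

theorem windowCount_self (H : Finset (Fin n)) (J : ℤ) :
    windowCount H J J = if residue n J ∈ H then 1 else 0 := by
  unfold windowCount
  rw [Finset.Icc_self, Finset.filter_singleton]
  split_ifs <;> simp

theorem exists_window_shift (J t x : ℤ) :
    ∃ l : ℤ, (t + l * n ≤ J ∧ J ≤ x + l * n) ∨ (J < t + l * n ∧ x + l * n < J + n) := by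
  have hn := natCast_pos_int (n := n)
  have h1 := Int.mul_ediv_add_emod (J - t) n
  have h2 := Int.emod_nonneg (J - t) hn.ne'
  have h3 := Int.emod_lt_of_pos (J - t) hn
  have h4 : t + (J - t) / n * n = J - (J - t) % n := by linear_combination h1
  have h5 : ((J - t) / n + 1) * n = (J - t) / n * n + n := by ring
  by_cases h : J ≤ x + (J - t) / n * n
  · exact ⟨(J - t) / n, Or.inl ⟨by omega, h⟩⟩
  · exact ⟨(J - t) / n + 1, Or.inr ⟨by omega, by omega⟩⟩

namespace DecoratedPerm

/-- The bounds on `[t, J - 1]` and `[J + 1, x]` add up, no chord is lost in the split, and `J`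
contributes a position but no element. -/
theorem windowCount_le_of_no_chord (p : DecoratedPerm n) {H : Finset (Fin n)}
    (hH : H ∈ p.positroid) {J t x : ℤ} (hJ : residue n J ∉ H) (ht : t ≤ J) (hx : J ≤ x)
    (htx : x < t + n) (h : ∀ m, t ≤ m → m ≤ J → J ≤ p.lift m → ¬ p.lift m ≤ x) :
    windowCount H t x ≤ x - t - chordCount p.lift t x := by
  have h1 := ((mem_positroid_iff p H).1 hH).2
  have h2 := h1 t (J - 1) (by omega) (by omega)
  have h3 := h1 (J + 1) x (by omega) (by omega)
  have h4 := chordCount_split p.isBoundedAffine_lift.le ht hx h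
  have h5 := windowCount_split H (t := t) (e := J) (x := x) ht (by omega)
  have h6 := windowCount_split H (t := J) (e := J + 1) (x := x) (by omega) (by omega)
  rw [add_sub_cancel_right, windowCount_self, if_neg hJ] at h6
  omega

/-- A criterion for the positroid of `m` to be the deletion of one element from that of `p`:
the chords of `m` in a window are those of `p`, with one more in a window that
contains the deleted element but no chord of `p` over it. -/
theorem positroid_eq_setRestriction (p m : DecoratedPerm n) (J : ℤ)
    (hJ : p.lift J ≠ J + n)
    (hout : ∀ t x : ℤ, J < t → x < J + n → chordCount m.lift t x = chordCount p.lift t x)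
    (hin : ∀ t x i : ℤ, t ≤ i → i ≤ J → J ≤ p.lift i → p.lift i ≤ x → x < t + n →
      chordCount m.lift t x = chordCount p.lift t x)
    (hin' : ∀ t x : ℤ, t ≤ J → J ≤ x → x < t + n →
      (∀ i, t ≤ i → i ≤ J → J ≤ p.lift i → ¬ p.lift i ≤ x) →
      chordCount m.lift t x = chordCount p.lift t x + 1) :
    m.positroid = setRestriction p.positroid {residue n J}ᶜ := by
  have hn := natCast_pos_int (n := n)
  have hp := p.isBoundedAffine_lift
  have hm := m.isBoundedAffine_lift
  have hcard : ∀ t, chordCount m.lift t (t + n - 1) = chordCount p.lift t (t + n - 1) := by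
    intro t
    rw [chordCount_window hm t J, chordCount_window hp t J]
    -- The window `[J, J + n - 1]` contains the chord of `J`, as its length is not `n`; so the ranks
    -- agree.
    have := hp.le_add J
    exact hin J _ J le_rfl le_rfl (hp.le J) (by omega) (by omega)
  have hle : ∀ t x : ℤ, t ≤ J → J ≤ x → x < t + n →
      chordCount p.lift t x ≤ chordCount m.lift t x := by
    intro t x h1 h2 h3
    by_cases h : ∃ i, t ≤ i ∧ i ≤ J ∧ J ≤ p.lift i ∧ p.lift i ≤ x
    · obtain ⟨i, a, b, c, d⟩ := h
      exact (hin t x i a b c d h3).ge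
    · push Not at h
      have := hin' t x h1 h2 h3 fun i a b c => not_le.2 (h i a b c)
      omega
  ext H
  rw [mem_setRestriction_compl_singleton, mem_positroid_iff m]
  constructor
  · rintro ⟨h1, h2⟩
    constructor
    · rw [mem_positroid_iff]
      refine ⟨fun t => by rw [h1 t, hcard], fun t x htx htx' => ?_⟩
      obtain ⟨l, hl⟩ := exists_window_shift (n := n) J t x
      have h3 := h2 (t + l * n) (x + l * n) (by omega) (by omega)
      rw [← windowCount_add_mul _ _ _ l, ← chordCount_add_mul hp _ _ l]
      rcases hl with hl | hl
      · have := hle _ _ hl.1 hl.2 (by omega)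
        omega
      · have := hout _ _ hl.1 hl.2
        omega
    · intro hmem
      -- On the one-point window at `J` the map `m.lift` has a chord, either inherited from `p` or
      -- added by `hin'`, so the bound there is `0`.
      have h3 := h2 J J (by omega) (by omega)
      rw [windowCount_self, if_pos hmem] at h3
      by_cases h : p.lift J ≤ J
      · have h4 := hin J J J le_rfl le_rfl (hp.le J) h (by omega)
        have h5 := chordCount_sub_succ p.lift (le_refl J)
        have h6 := chordCount_nonneg p.lift (J + 1) J
        rw [if_pos h] at h5
        omega
      · have h4 := hin' J J le_rfl le_rfl (by omega) fun i a b _ => by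
          rwa [le_antisymm b a]
        have h6 := chordCount_nonneg p.lift J J
        omega
  · rintro ⟨hH, hmem⟩
    have hH' := (mem_positroid_iff p H).1 hH
    refine ⟨fun t => by rw [hH'.1 t, hcard], fun t x htx htx' => ?_⟩
    obtain ⟨l, hl⟩ := exists_window_shift (n := n) J t x
    rw [← windowCount_add_mul _ _ _ l, ← chordCount_add_mul hm _ _ l]
    have h3 := hH'.2 (t + l * n) (x + l * n) (by omega) (by omega)
    rcases hl with hl | hl
    · by_cases h : ∃ i, t + l * n ≤ i ∧ i ≤ J ∧ J ≤ p.lift i ∧ p.lift i ≤ x + l * n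
      · obtain ⟨i, a, b, c, d⟩ := h
        have := hin _ _ i a b c d (by omega)
        omega
      · push Not at h
        have h' : ∀ i, t + l * n ≤ i → i ≤ J → J ≤ p.lift i → ¬ p.lift i ≤ x + l * n :=
          fun i a b c => not_le.2 (h i a b c)
        have h4 := hin' _ _ hl.1 hl.2 (by omega) h'
        have h5 := p.windowCount_le_of_no_chord hH hmem hl.1 hl.2 (by omega) h'
        omega
    · have := hout _ _ hl.1 hl.2
      omega

theorem positroid_eq_setRestriction_of_lift_eq_self (p : DecoratedPerm n) {J : ℤ}
    (hJ : p.lift J = J) : p.positroid = setRestriction p.positroid {residue n J}ᶜ := by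
  have hn := natCast_pos_int (n := n)
  refine positroid_eq_setRestriction p p J (by omega) (fun _ _ _ _ => rfl)
    (fun _ _ _ _ _ _ _ _ => rfl) fun t x h1 h2 h3 h => ?_
  exact absurd (hJ.le.trans h2) (h J h1 le_rfl hJ.ge)

theorem setRestriction_eq_empty_of_lift_eq_add (p : DecoratedPerm n) {J : ℤ}
    (hJ : p.lift J = J + n) : setRestriction p.positroid {residue n J}ᶜ = ∅ := by
  have hn := natCast_pos_int (n := n)
  rw [Set.eq_empty_iff_forall_notMem]
  intro H hH
  rw [mem_setRestriction_compl_singleton] at hH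
  have h1 := p.windowCount_le_of_no_chord hH.1 (J := J) (t := J) (x := J + n - 1) hH.2 le_rfl
    (by omega) (by omega) fun i a b _ => by rw [le_antisymm b a]; omega
  have h2 := ((mem_positroid_iff p H).1 hH.1).1 J
  rw [windowCount_full] at h1
  omega

end DecoratedPerm

end Deletion

/-! ### Effect of an affine transposition on chord counts. -/

section AffineSwap

variable {n : ℕ} [NeZero n]

/-- The affine transposition that interchanges `u + l n` and `v + l n` for every integer `l`. -/
noncomputable def affineSwap (n : ℕ) [NeZero n] (u v m : ℤ) : ℤ :=
  if residue n m = residue n u then m + (v - u)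
  else if residue n m = residue n v then m + (u - v) else m

theorem residue_add_sub_of_eq {m u : ℤ} (h : residue n m = residue n u) (v : ℤ) :
    residue n (m + (v - u)) = residue n v := by
  rw [residue_eq_iff] at h ⊢
  convert h using 1
  ring

theorem affineSwap_left (u v : ℤ) : affineSwap n u v u = v := by
  unfold affineSwap; rw [if_pos rfl]; ring

theorem affineSwap_right {u v : ℤ} (h : residue n u ≠ residue n v) :
    affineSwap n u v v = u := by
  unfold affineSwap; rw [if_neg h.symm, if_pos rfl]; ring

theorem affineSwap_of_ne {u v m : ℤ} (h : residue n m ≠ residue n u)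
    (h' : residue n m ≠ residue n v) : affineSwap n u v m = m := by
  unfold affineSwap; rw [if_neg h, if_neg h']

theorem affineSwap_add (u v m : ℤ) : affineSwap n u v (m + n) = affineSwap n u v m + n := by
  unfold affineSwap
  rw [residue_add_self]
  split_ifs <;> ring

theorem affineSwap_involutive {u v : ℤ} (h : residue n u ≠ residue n v) :
    Function.Involutive (affineSwap n u v) := by
  intro m
  by_cases h1 : residue n m = residue n u
  · have h2 := residue_add_sub_of_eq h1 v
    unfold affineSwap
    rw [if_pos h1, if_neg (by rw [h2]; exact h.symm), if_pos h2]
    ring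
  · by_cases h3 : residue n m = residue n v
    · have h2 := residue_add_sub_of_eq h3 u
      unfold affineSwap
      rw [if_neg h1, if_pos h3, if_pos h2]
      ring
    · rw [affineSwap_of_ne h1 h3, affineSwap_of_ne h1 h3]

theorem map_eq_of_residue_eq {f : ℤ → ℤ} (hf : ∀ m, f (m + n) = f m + n) {m u : ℤ}
    (h : residue n m = residue n u) : f m = f u + (m - u) := by
  obtain ⟨l, hl⟩ := residue_eq_iff.1 h
  obtain rfl : m = u + l * n := by linear_combination hl
  rw [map_add_mul_of_map_add hf]; ring

theorem card_eq_card_erase_erase_add {α : Type*} [DecidableEq α] (s : Finset α) {u v : α}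
    (huv : u ≠ v) : s.card = ((s.erase u).erase v).card + (if u ∈ s then 1 else 0) +
      (if v ∈ s then 1 else 0) := by
  have h : ∀ (s : Finset α) (a : α), s.card = (s.erase a).card + if a ∈ s then 1 else 0 := by
    intro s a
    split_ifs with h
    · exact (Finset.card_erase_add_one h).symm
    · rw [Finset.erase_eq_of_notMem h, add_zero]
  have h2 := h (s.erase u) v
  simp only [Finset.mem_erase, ne_eq, huv.symm, not_false_eq_true, true_and] at h2
  rw [h s u, h2]
  ring

variable {F : ℤ → ℤ} {u v J : ℤ}

/-- A translate of `u` or `v` to the right of it is at least one period further, so its values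
before and after the exchange are both at least `J + n`, beyond `x`. -/
theorem comp_affineSwap_le_iff (hF : ∀ m, F (m + n) = F m + n) (hFu : J ≤ F u) (hFv : J ≤ F v) {x m : ℤ} (hx : x < J + n)
    (hmu : residue n m = residue n u → u < m) (hmv : residue n m = residue n v → v < m) :
    F (affineSwap n u v m) ≤ x ↔ F m ≤ x := by
  have large : ∀ {w m : ℤ}, residue n m = residue n w → w < m → w + n ≤ m := by
    intro w m h h'
    obtain ⟨l, hl⟩ := residue_eq_iff.1 h
    have hn := natCast_pos_int (n := n)
    have : 0 < l := by
      by_contra hl'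
      nlinarith
    nlinarith
  by_cases h1 : residue n m = residue n u
  · have h2 := large h1 (hmu h1)
    have h3 := map_eq_of_residue_eq hF h1
    have h4 := map_eq_of_residue_eq hF (residue_add_sub_of_eq h1 v)
    unfold affineSwap
    rw [if_pos h1]
    omega
  · by_cases h3 : residue n m = residue n v
    · have h2 := large h3 (hmv h3)
      have h4 := map_eq_of_residue_eq hF h3
      have h5 := map_eq_of_residue_eq hF (residue_add_sub_of_eq h3 u)
      unfold affineSwap
      rw [if_neg h1, if_pos h3]
      omega
    · rw [affineSwap_of_ne h1 h3]

theorem chordCount_comp_affineSwap_of_lt (hF : ∀ m, F (m + n) = F m + n) (hu : u ≤ J)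
    (hv : v ≤ J) (hFu : J ≤ F u) (hFv : J ≤ F v) {t x : ℤ} (ht : J < t) (hx : x < J + n) :
    chordCount (F ∘ affineSwap n u v) t x = chordCount F t x := by
  unfold chordCount
  congr 2
  refine Finset.filter_congr fun m hm => ?_
  rw [Finset.mem_Icc] at hm
  exact comp_affineSwap_le_iff hF hFu hFv hx (fun _ => by omega) (fun _ => by omega)

/-- In such a window only the chords at `u` and `v` themselves can change, so the old and new sets
agree once these two points are erased. -/
theorem chordCount_comp_affineSwap (hF : ∀ m, F (m + n) = F m + n)
    (huv : residue n u ≠ residue n v) (hu : u ≤ J) (hv : v ≤ J) (hFu : J ≤ F u) (hFv : J ≤ F v)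
    {t x : ℤ} (ht : t ≤ J) (hJx : J ≤ x) (hx : x < t + n) :
    chordCount (F ∘ affineSwap n u v) t x + (if t ≤ u ∧ F u ≤ x then 1 else 0) +
        (if t ≤ v ∧ F v ≤ x then 1 else 0) =
      chordCount F t x + (if t ≤ u ∧ F v ≤ x then 1 else 0) +
        (if t ≤ v ∧ F u ≤ x then 1 else 0) := by
  have huv' : u ≠ v := fun h => huv (by rw [h])
  have hres : ∀ {w m : ℤ}, t ≤ m → w ≤ J → m ≠ w → m ≤ x → residue n m = residue n w →
      w < m := by
    intro w m h1 h2 h3 h4 h5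
    by_contra h
    exact h3 ((residue_eq_iff_of_mem (by omega) (by omega)).1 h5)
  have e1 := card_eq_card_erase_erase_add ((Finset.Icc t x).filter (fun m => F m ≤ x)) huv'
  have e2 := card_eq_card_erase_erase_add
    ((Finset.Icc t x).filter (fun m => (F ∘ affineSwap n u v) m ≤ x)) huv'
  have e3 : (((Finset.Icc t x).filter (fun m => (F ∘ affineSwap n u v) m ≤ x)).erase u).erase v =
      (((Finset.Icc t x).filter (fun m => F m ≤ x)).erase u).erase v := by
    ext m
    simp only [Finset.mem_erase, Finset.mem_filter, Finset.mem_Icc, Function.comp_apply]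
    refine and_congr_right fun hmv => and_congr_right fun hmu => and_congr_right fun hm => ?_
    exact comp_affineSwap_le_iff hF hFu hFv (by omega)
      (hres hm.1 hu hmu hm.2) (hres hm.1 hv hmv hm.2)
  rw [e3] at e2
  simp only [Finset.mem_filter, Finset.mem_Icc, Function.comp_apply, affineSwap_left,
    affineSwap_right huv, hu.trans hJx, hv.trans hJx, and_true] at e1 e2
  unfold chordCount
  zify at e1 e2
  simp only [Function.comp_apply]
  linarith

end AffineSwap

/-! ### The restriction algorithm and its loop invariant. -/

theorem cycLT_residue_iff {n : ℕ} [NeZero n] (a b c : ℤ) :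
    CycLT (residue n a) (residue n b) (residue n c) ↔ (b - a) % n < (c - a) % n := by
  rw [← residue_sub_val, ← residue_sub_val]
  exact Int.ofNat_lt.symm

theorem DecoratedPerm.partialCol_residue {n : ℕ} [NeZero n] (p : DecoratedPerm n) (m : ℤ) :
    p.partialCol (residue n m) =
      if p.lift m = m then some 1 else if p.lift m = m + n then some (-1) else none := by
  have h1 := p.lift_eq_self_iff m
  have h2 := p.lift_eq_add_iff m
  unfold DecoratedPerm.partialCol
  by_cases h : p.perm (residue n m) = residue n m
  · simp only [h, exists_true_left] at h1 h2
    rcases Int.units_eq_one_or (p.col ⟨_, h⟩) with e | e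
    · rw [dif_pos h, if_pos (h1.2 (by rw [e]; decide)), e]
    · have h3 : p.lift m ≠ m := fun h' => h1.1 h' e
      rw [dif_pos h, if_neg h3, if_pos (h2.2 e), e]
  · simp only [h, IsEmpty.exists_iff, iff_false] at h1 h2
    rw [dif_neg h, if_neg h1, if_neg h2]

namespace RestrictionAlg

variable {n : ℕ} [NeZero n]

/-- The loop invariant. Here `J` lifts the deleted element, `z` is the preimage of `J` under
the lift of `p`, `A` lifts the current position, and `F z` lifts the carried value. The map `F`
lifts the permutation that results from an immediate final assignment. -/
structure Invariant (p : DecoratedPerm n) (J z : ℤ) (s : State n) (A : ℤ) (F : ℤ → ℤ) : Prop where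
  bijective : Function.Bijective F
  map_add : ∀ m, F (m + n) = F m + n
  z_le : z ≤ A
  lt_J : A < J
  pos_eq : s.a = residue n A
  carried_eq : s.q = residue n (F z)
  mu_eq : ∀ m, residue n m ≠ residue n z → s.mu (residue n m) = residue n (F m)
  col_eq : ∀ m, residue n m ≠ residue n z → s.col' (residue n m) =
    if F m = m then some 1 else if F m = m + n then some (-1) else none
  col_z : s.col' (residue n z) = none
  bounded : ∀ m, residue n m ≠ residue n z → m ≤ F m ∧ F m ≤ m + n
  unvisited : ∀ m, z < m → m ≤ A → F m = p.lift m
  J_lt : J < F z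
  carried_le : F z ≤ A + n
  attained : ∃ b, A < b ∧ b ≤ J ∧ p.lift b = F z
  minimal : ∀ m, A < m → m ≤ J → J ≤ p.lift m → F z ≤ p.lift m
  chords_out : ∀ t x : ℤ, J < t → x < J + n → chordCount F t x = chordCount p.lift t x
  chords_of_chord : ∀ t x i : ℤ, t ≤ i → i ≤ J → A < i ∨ i = z → J ≤ p.lift i → p.lift i ≤ x →
    x < t + n → chordCount F t x = chordCount p.lift t x
  chords_of_no_chord : ∀ t x : ℤ, t ≤ J → J ≤ x → x < t + n →
    (∀ i, t ≤ i → i ≤ J → A < i ∨ i = z → J ≤ p.lift i → ¬ p.lift i ≤ x) →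
      chordCount F t x = chordCount p.lift t x + 1

variable {p : DecoratedPerm n} {J z : ℤ}

theorem preimage_bounds (hJ : p.perm (residue n J) ≠ residue n J) (hz : p.lift z = J) :
    z < J ∧ J - n < z := by
  have hp := p.isBoundedAffine_lift
  have h1 := hp.le z
  have h2 := hp.le_add z
  have key : residue n z ≠ residue n J := fun h => hJ (by
    conv_lhs => rw [← h]
    rw [← DecoratedPerm.residue_lift, hz])
  constructor
  · refine lt_of_le_of_ne (by omega) fun h => key (by rw [h])
  · refine lt_of_le_of_ne (by omega) fun h => key ?_
    rw [← h, ← residue_add_self, sub_add_cancel]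

theorem invariant_init (hJ : p.perm (residue n J) ≠ residue n J) (hz : p.lift z = J) :
    Invariant p J z (init p (residue n J)) (J - 1) (p.lift ∘ affineSwap n z J) := by
  have hn := natCast_pos_int (n := n)
  have hp := p.isBoundedAffine_lift
  obtain ⟨hz1, hz2⟩ := preimage_bounds hJ hz
  have hzJ : residue n z ≠ residue n J := fun h => by
    have := (residue_eq_iff_of_mem (by omega) (by omega)).1 h; omega
  have hFz : (p.lift ∘ affineSwap n z J) z = p.lift J := by
    rw [Function.comp_apply, affineSwap_left]
  have hFJ : (p.lift ∘ affineSwap n z J) J = J := by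
    rw [Function.comp_apply, affineSwap_right hzJ, hz]
  have hadd : ∀ m, (p.lift ∘ affineSwap n z J) (m + n) = (p.lift ∘ affineSwap n z J) m + n := by
    intro m; rw [Function.comp_apply, affineSwap_add, hp.map_add]; rfl
  have hFJ' : ∀ m, residue n m = residue n J → (p.lift ∘ affineSwap n z J) m = m := by
    intro m h; rw [map_eq_of_residue_eq hadd h, hFJ]; ring
  have hF : ∀ m, residue n m ≠ residue n z → residue n m ≠ residue n J →
      (p.lift ∘ affineSwap n z J) m = p.lift m := by
    intro m h h'; rw [Function.comp_apply, affineSwap_of_ne h h']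
  have hJ1 : p.lift J ≠ J := fun h => hJ (by rw [← DecoratedPerm.residue_lift, h])
  have hJ2 : p.lift J ≠ J + n := fun h => hJ (by
    rw [← DecoratedPerm.residue_lift, h, residue_add_self])
  have hJ3 := hp.le J
  have hJ4 := hp.le_add J
  -- The new loop at `J` adds one, and inclusion-exclusion cancels it exactly when the window
  -- contains the chord from `z` to `J` or the chord leaving `J`.
  have hchord : ∀ t x : ℤ, t ≤ J → J ≤ x → x < t + n →
      chordCount (p.lift ∘ affineSwap n z J) t x + (if t ≤ z then 1 else 0) +
        (if p.lift J ≤ x then 1 else 0) =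
      chordCount p.lift t x + (if t ≤ z ∧ p.lift J ≤ x then 1 else 0) + 1 := by
    intro t x h1 h2 h3
    have := chordCount_comp_affineSwap hp.map_add hzJ hz1.le le_rfl hz.ge hJ3 h1 h2 h3
    simpa only [hz, h1, h2, and_true, true_and, if_true] using this
  constructor
  case bijective => exact hp.bijective.comp (affineSwap_involutive hzJ).bijective
  case map_add => exact hadd
  case z_le => omega
  case lt_J => omega
  case pos_eq => rw [residue_sub_one]; rfl
  case carried_eq => rw [hFz, DecoratedPerm.residue_lift]; rfl
  case mu_eq =>
    intro m hm
    by_cases h : residue n m = residue n J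
    · rw [hFJ' m h, h]; exact Function.update_self ..
    · rw [hF m hm h, DecoratedPerm.residue_lift]; exact Function.update_of_ne h ..
  case col_eq =>
    intro m hm
    by_cases h : residue n m = residue n J
    · rw [hFJ' m h, h, if_pos rfl]; exact Function.update_self ..
    · rw [hF m hm h, ← DecoratedPerm.partialCol_residue]; exact Function.update_of_ne h ..
  case col_z =>
    have : p.partialCol (residue n z) = none := by
      rw [DecoratedPerm.partialCol_residue, if_neg (by omega), if_neg (by omega)]
    rw [← this]; exact Function.update_of_ne hzJ ..
  case bounded =>
    intro m hm
    by_cases h : residue n m = residue n J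
    · rw [hFJ' m h]; omega
    · rw [hF m hm h]; exact ⟨hp.le m, hp.le_add m⟩
  case unvisited =>
    intro m h1 h2
    refine hF m (fun h => ?_) (fun h => ?_)
    · have := (residue_eq_iff_of_mem (by omega) (by omega)).1 h; omega
    · have := (residue_eq_iff_of_mem (by omega) (by omega)).1 h; omega
  case J_lt => omega
  case carried_le => omega
  case attained => exact ⟨J, by omega, le_rfl, hFz.symm⟩
  case minimal =>
    intro m h1 h2 _
    rw [hFz, show m = J by omega]
  case chords_out =>
    intro t x h1 h2
    exact chordCount_comp_affineSwap_of_lt hp.map_add hz1.le le_rfl hz.ge hJ3 h1 h2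
  case chords_of_chord =>
    intro t x i h1 h2 h3 h4 h5 h6
    have h7 := hchord t x (by omega) (by omega) h6
    rcases h3 with h3 | rfl
    · obtain rfl : i = J := by omega
      simp only [h5, and_true, if_true] at h7
      omega
    · simp only [h1, true_and, if_true] at h7
      omega
  case chords_of_no_chord =>
    intro t x h1 h2 h3 h
    have h7 := hchord t x h1 h2 h3
    have h8 := h J h1 le_rfl (Or.inl (by omega)) hJ3
    have h9 : ¬ t ≤ z := fun h' => h z h' hz1.le (Or.inr rfl) hz.ge (by omega)
    simp only [h8, h9, and_false, if_false] at h7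
    omega

namespace Invariant

variable {s : State n} {A : ℤ} {F : ℤ → ℤ}

/-- Pigeonhole. Otherwise, by minimality of the carried value, every point of `[A, J]` has its
image, or its image shifted back by `n`, in `[A, J)`. That interval has one point fewer,
contradicting injectivity modulo `n`. -/
theorem lt_lift_of_carried_eq (hJ : p.perm (residue n J) ≠ residue n J) (hz : p.lift z = J)
    (h : Invariant p J z s A F) (hzA : z < A) (hq : F z = A + n) : J < p.lift A := by
  have hn := natCast_pos_int (n := n)
  have hp := p.isBoundedAffine_lift
  obtain ⟨hz1, hz2⟩ := preimage_bounds hJ hz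
  have hAJ := h.lt_J
  have hA := hp.le A
  have hne : ∀ m, m ≠ z → p.lift m ≠ J := fun m hm h' => hm (hp.bijective.1 (h'.trans hz.symm))
  have hne' : ∀ m, m ≠ z + n → p.lift m ≠ J + n := fun m hm h' =>
    hm (hp.bijective.1 (by rw [h', hp.map_add, hz]))
  by_contra hlt
  have hlt' : p.lift A < J := by have := hne A (by omega); omega
  obtain ⟨m, hm, m', hm', hmm, he⟩ := Finset.exists_ne_map_eq_of_card_lt_of_maps_to
    (s := Finset.Icc A J) (t := Finset.Ico A J)
    (f := fun m => if p.lift m < J then p.lift m else p.lift m - n)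
    (by rw [Int.card_Icc, Int.card_Ico]; omega)
    (fun m hm => by
      simp only [Finset.coe_Icc, Set.mem_Icc, Finset.coe_Ico, Set.mem_Ico] at hm ⊢
      have h1 := hp.le m
      have h2 := hp.le_add m
      split_ifs with h3
      · omega
      · have h4 : A < m := by
          refine lt_of_le_of_ne hm.1 fun e => h3 (e ▸ hlt')
        have h5 := h.minimal m h4 hm.2 (by omega)
        have h6 := hne' m (by omega)
        omega)
  rw [Finset.mem_Icc] at hm hm'
  have h1 := hp.map_add m
  have h2 := hp.map_add m'
  have h3 : p.lift m ≠ p.lift m' := fun e => hmm (hp.bijective.1 e)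
  have h4 : p.lift m ≠ p.lift (m' + n) := fun e => by have := hp.bijective.1 e; omega
  have h5 : p.lift (m + n) ≠ p.lift m' := fun e => by have := hp.bijective.1 e; omega
  split_ifs at he <;> omega

/-- Seen from `a`, cyclic comparison is comparison of lifts, except that a lift equal to `A + n`
gets position `0`. For the carried value this is the separate case `q = a`, where the linear
condition holds by `lt_lift_of_carried_eq`. -/
theorem body_condition_iff (hJ : p.perm (residue n J) ≠ residue n J) (hz : p.lift z = J)
    (h : Invariant p J z s A F) (hzA : z < A) :
    (s.q = s.a ∨ (CycLT s.a (p.perm s.a) s.q ∧ CycLT s.a (residue n J) (p.perm s.a))) ↔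
      J < p.lift A ∧ p.lift A < F z := by
  have hn := natCast_pos_int (n := n)
  have hp := p.isBoundedAffine_lift
  obtain ⟨hz1, hz2⟩ := preimage_bounds hJ hz
  have hAJ := h.lt_J
  have hJF := h.J_lt
  have hFA := h.carried_le
  have hA1 := hp.le A
  have hA2 := hp.le_add A
  have hne : p.lift A ≠ F z := by
    obtain ⟨b, hb1, hb2, hb3⟩ := h.attained
    rw [← hb3]
    intro e
    have := hp.bijective.1 e
    omega
  rw [h.pos_eq, h.carried_eq, ← DecoratedPerm.residue_lift, cycLT_residue_iff, cycLT_residue_iff]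
  by_cases hq : F z = A + n
  · have := h.lt_lift_of_carried_eq hJ hz hzA hq
    have h2 : residue n (F z) = residue n A := by rw [hq, residue_add_self]
    simp only [h2, true_or, true_iff]
    omega
  · have h2 : residue n (F z) ≠ residue n A := fun e => by
      have := (residue_eq_iff_of_mem (by omega) (by omega)).1 e; omega
    rw [Int.emod_eq_of_lt (a := F z - A) (by omega) (by omega),
      Int.emod_eq_of_lt (a := J - A) (by omega) (by omega)]
    simp only [h2, false_or]
    by_cases h3 : p.lift A = A + n
    · rw [h3, show A + n - A = (n : ℤ) by ring, Int.emod_self]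
      omega
    · rw [Int.emod_eq_of_lt (a := p.lift A - A) (by omega) (by omega)]
      omega

/-- Skipping `A` is harmless: its chord either misses `J` or ends no earlier than `F z`. In the
latter case any window containing it contains the chord ending at `F z` that starts in `(A, J]`. -/
theorem body_of_not (hJ : p.perm (residue n J) ≠ residue n J) (hz : p.lift z = J)
    (h : Invariant p J z s A F) (hzA : z < A) (hc : ¬ (J < p.lift A ∧ p.lift A < F z)) :
    Invariant p J z (body p (residue n J) s) (A - 1) F := by
  have hp := p.isBoundedAffine_lift
  obtain ⟨hz1, hz2⟩ := preimage_bounds hJ hz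
  have hne : p.lift A ≠ J := fun h' => by
    have := hp.bijective.1 (h'.trans hz.symm); omega
  have hskip : J ≤ p.lift A → F z ≤ p.lift A := fun h' => by omega
  obtain ⟨b, hb1, hb2, hb3⟩ := h.attained
  have hJF := h.J_lt
  rw [body, if_neg (by rwa [h.body_condition_iff hJ hz hzA])]
  exact {
    bijective := h.bijective
    map_add := h.map_add
    z_le := by omega
    lt_J := by have := h.lt_J; omega
    pos_eq := by rw [residue_sub_one, ← h.pos_eq]
    carried_eq := h.carried_eq
    mu_eq := h.mu_eq
    col_eq := h.col_eq
    col_z := h.col_z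
    bounded := h.bounded
    unvisited := fun m h1 h2 => h.unvisited m h1 (by omega)
    J_lt := h.J_lt
    carried_le := by
      refine Int.le_of_lt_add_one ?_
      have h1 := h.carried_le
      have h2 : F z ≠ A + n := fun e => hc ⟨h.lt_lift_of_carried_eq hJ hz hzA e, by
        have h3 := hp.le_add A
        have h4 : p.lift A ≠ F z := fun e' => by
          have := hp.bijective.1 (e'.trans hb3.symm); omega
        omega⟩
      omega
    attained := ⟨b, by omega, hb2, hb3⟩
    minimal := fun m h1 h2 h3 => by
      rcases (show A = m ∨ A < m by omega) with rfl | h4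
      · exact hskip h3
      · exact h.minimal m h4 h2 h3
    chords_out := h.chords_out
    chords_of_chord := fun t x i h1 h2 h3 h4 h5 h6 => by
      by_cases e : i = A
      · subst e
        have := hskip h4
        exact h.chords_of_chord t x b (by omega) hb2 (Or.inl hb1) (by omega) (by omega) h6
      · exact h.chords_of_chord t x i h1 h2 (by omega) h4 h5 h6
    chords_of_no_chord := fun t x h1 h2 h3 h4 =>
      h.chords_of_no_chord t x h1 h2 h3 fun i a b c => h4 i a b (by omega) }

/-- The exchange lowers the count exactly in the windows with `z < t ≤ A` and `p.lift A ≤ x < F z`.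
These contain the chord of `A` but none of those treated before, so they are the ones whose extra
unit must go. -/
theorem body_of (hJ : p.perm (residue n J) ≠ residue n J) (hz : p.lift z = J)
    (h : Invariant p J z s A F) (hzA : z < A) (hc : J < p.lift A ∧ p.lift A < F z) :
    Invariant p J z (body p (residue n J) s) (A - 1) (F ∘ affineSwap n z A) := by
  have hn := natCast_pos_int (n := n)
  have hp := p.isBoundedAffine_lift
  obtain ⟨hz1, hz2⟩ := preimage_bounds hJ hz
  have hAJ := h.lt_J
  have hJF := h.J_lt
  have hFA := h.carried_le
  have hA2 := hp.le_add A
  have hFeq : F A = p.lift A := h.unvisited A hzA le_rfl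
  have hzAr : residue n z ≠ residue n A := fun e => by
    have := (residue_eq_iff_of_mem (by omega) (by omega)).1 e; omega
  obtain ⟨b, hb1, hb2, hb3⟩ := h.attained
  have hGz : (F ∘ affineSwap n z A) z = p.lift A := by
    rw [Function.comp_apply, affineSwap_left, hFeq]
  have hGA : (F ∘ affineSwap n z A) A = F z := by
    rw [Function.comp_apply, affineSwap_right hzAr]
  have hadd : ∀ m, (F ∘ affineSwap n z A) (m + n) = (F ∘ affineSwap n z A) m + n := by
    intro m; rw [Function.comp_apply, affineSwap_add, h.map_add]; rfl
  have hGA' : ∀ m, residue n m = residue n A → (F ∘ affineSwap n z A) m = F z + (m - A) := by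
    intro m e; rw [map_eq_of_residue_eq hadd e, hGA]
  have hG : ∀ m, residue n m ≠ residue n z → residue n m ≠ residue n A →
      (F ∘ affineSwap n z A) m = F m := by
    intro m e e'; rw [Function.comp_apply, affineSwap_of_ne e e']
  have hchord : ∀ t x : ℤ, t ≤ J → J ≤ x → x < t + n →
      chordCount (F ∘ affineSwap n z A) t x + (if t ≤ z ∧ F z ≤ x then 1 else 0) +
        (if t ≤ A ∧ p.lift A ≤ x then 1 else 0) =
      chordCount F t x + (if t ≤ z ∧ p.lift A ≤ x then 1 else 0) +
        (if t ≤ A ∧ F z ≤ x then 1 else 0) := by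
    intro t x h1 h2 h3
    have := chordCount_comp_affineSwap h.map_add hzAr hz1.le hAJ.le hJF.le (by omega) h1 h2 h3
    rwa [hFeq] at this
  have hmu : ∀ m, residue n m ≠ residue n z → Function.update s.mu s.a s.q (residue n m) =
      residue n ((F ∘ affineSwap n z A) m) := by
    intro m hm
    by_cases e : residue n m = residue n A
    · rw [h.pos_eq, e, Function.update_self, h.carried_eq, hGA' m e, eq_comm, residue_eq_iff]
      convert residue_eq_iff.1 e using 1
      ring
    · rw [h.pos_eq, Function.update_of_ne e, hG m hm e, h.mu_eq m hm]
  have hcol : ∀ m, residue n m ≠ residue n z → (assign s).col' (residue n m) =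
      if (F ∘ affineSwap n z A) m = m then some 1 else
        if (F ∘ affineSwap n z A) m = m + n then some (-1) else none := by
    intro m hm
    have hqa : s.q = s.a ↔ F z = A + n := by
      rw [h.carried_eq, h.pos_eq]
      constructor
      · intro e
        rw [← residue_add_self A] at e
        exact (residue_eq_iff_of_mem (by omega) (by omega)).1 e
      · intro e
        rw [e, residue_add_self]
    by_cases e : residue n m = residue n A
    · rw [hGA' m e, if_neg (by omega), e, assign]
      by_cases e2 : F z = A + n
      · dsimp only
        rw [if_pos (hqa.2 e2), if_pos (by omega), h.pos_eq, Function.update_self]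
      · dsimp only
        rw [if_neg (hqa.not.2 e2), if_neg (by omega), h.col_eq A hzAr.symm, if_neg (by omega),
          if_neg (by omega)]
    · rw [hG m hm e, ← h.col_eq m hm, assign]
      dsimp only
      split_ifs
      · rw [h.pos_eq, Function.update_of_ne e]
      · rfl
  have hcolz : (assign s).col' (residue n z) = none := by
    rw [assign]
    dsimp only
    split_ifs
    · rw [h.pos_eq, Function.update_of_ne hzAr, h.col_z]
    · exact h.col_z
  rw [body, if_pos (by rwa [h.body_condition_iff hJ hz hzA])]
  exact {
    bijective := h.bijective.comp (affineSwap_involutive hzAr).bijective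
    map_add := hadd
    z_le := by omega
    lt_J := by omega
    pos_eq := by rw [residue_sub_one, ← h.pos_eq]
    carried_eq := by rw [hGz, DecoratedPerm.residue_lift, ← h.pos_eq]
    mu_eq := hmu
    col_eq := hcol
    col_z := hcolz
    bounded := fun m hm => by
      by_cases e : residue n m = residue n A
      · rw [hGA' m e]; omega
      · rw [hG m hm e]; exact h.bounded m hm
    unvisited := fun m h1 h2 => by
      rw [hG m, h.unvisited m h1 (by omega)]
      · intro e
        have := (residue_eq_iff_of_mem (by omega) (by omega)).1 e; omega
      · intro e
        have := (residue_eq_iff_of_mem (by omega) (by omega)).1 e; omega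
    J_lt := by rw [hGz]; exact hc.1
    carried_le := by rw [hGz]; omega
    attained := ⟨A, by omega, hAJ.le, hGz.symm⟩
    minimal := fun m h1 h2 h3 => by
      rw [hGz]
      rcases (show A = m ∨ A < m by omega) with rfl | h4
      · exact le_rfl
      · have := h.minimal m h4 h2 h3; omega
    chords_out := fun t x h1 h2 => by
      rw [← h.chords_out t x h1 h2]
      exact chordCount_comp_affineSwap_of_lt h.map_add hz1.le hAJ.le hJF.le (by omega) h1 h2
    chords_of_chord := fun t x i h1 h2 h3 h4 h5 h6 => by
      have h7 := hchord t x (by omega) (by omega) h6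
      -- In these cases the exchange leaves the count alone and a chord already accounted for lies
      -- in the window; otherwise the surplus of one is cancelled.
      by_cases hF : t ≤ z ∨ A < t ∨ F z ≤ x
      · have h8 : chordCount F t x = chordCount p.lift t x := by
          rcases (show i = A ∨ (A < i ∨ i = z) by omega) with rfl | e
          · rcases hF with hF | hF | hF
            · exact h.chords_of_chord t x z hF hz1.le (Or.inr rfl) hz.ge (by omega) h6
            · omega
            · exact h.chords_of_chord t x b (by omega) hb2 (Or.inl hb1) (by omega) (by omega) h6
          · exact h.chords_of_chord t x i h1 h2 e h4 h5 h6
        split_ifs at h7 <;> omega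
      · have h8 : chordCount F t x = chordCount p.lift t x + 1 := by
          refine h.chords_of_no_chord t x (by omega) (by omega) h6 fun i' a b c d => ?_
          rcases c with c | c
          · have := h.minimal i' c b d; omega
          · omega
        rcases (show i = A ∨ A < i by omega) with rfl | e
        · split_ifs at h7 <;> omega
        · have := h.minimal i e h2 h4
          omega
    chords_of_no_chord := fun t x h1 h2 h3 h4 => by
      have h7 := hchord t x h1 h2 h3
      have h8 := h.chords_of_no_chord t x h1 h2 h3 fun i a b c => h4 i a b (by omega)
      have h9 : ¬ t ≤ z := fun e => h4 z e hz1.le (Or.inr rfl) hz.ge (by omega)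
      have h10 : t ≤ A → ¬ p.lift A ≤ x := fun e => h4 A e hAJ.le (Or.inl (by omega)) hc.1.le
      split_ifs at h7 <;> omega }

theorem loop (hJ : p.perm (residue n J) ≠ residue n J) (hz : p.lift z = J)
    (h : Invariant p J z s A F) :
    ∃ s' F', Loop p (residue n J) s s' ∧ Invariant p J z s' z F' := by
  obtain ⟨k, hk⟩ : ∃ k : ℕ, A = z + k := ⟨(A - z).toNat, by have := h.z_le; omega⟩
  induction k generalizing s A F with
  | zero =>
    obtain rfl : A = z := by simpa using hk
    refine ⟨s, F, Loop.done s ?_, h⟩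
    rw [h.pos_eq, ← DecoratedPerm.residue_lift, hz]
  | succ k ih =>
    obtain ⟨hz1, hz2⟩ := preimage_bounds hJ hz
    have hAJ := h.lt_J
    push_cast at hk
    have hzA : z < A := by omega
    have hne : p.perm s.a ≠ residue n J := by
      rw [h.pos_eq, ← hz, DecoratedPerm.residue_lift, p.perm.injective.ne_iff]
      intro e
      have := (residue_eq_iff_of_mem (by omega) (by omega)).1 e
      omega
    obtain ⟨F₁, h₁⟩ : ∃ F₁, Invariant p J z (body p (residue n J) s) (A - 1) F₁ := by
      by_cases hc : J < p.lift A ∧ p.lift A < F z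
      · exact ⟨_, h.body_of hJ hz hzA hc⟩
      · exact ⟨_, h.body_of_not hJ hz hzA hc⟩
    obtain ⟨s', F', h2, h3⟩ := ih h₁ (by omega)
    exact ⟨s', F', Loop.step s s' hne h2, h3⟩

/-- Only at the end does the carried value fit its place: with `A = z` the bound `carried_le` reads
`F z ≤ z + n`. -/
theorem isBoundedAffine (h : Invariant p J z s z F) : IsBoundedAffine n F := by
  have key : ∀ m, m ≤ F m ∧ F m ≤ m + n := by
    intro m
    by_cases e : residue n m = residue n z
    · have h1 := map_eq_of_residue_eq h.map_add e
      have h2 := h.carried_le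
      have h3 := h.J_lt
      have h4 := h.lt_J
      omega
    · exact h.bounded m e
  exact ⟨h.bijective, h.map_add, fun m => (key m).1, fun m => (key m).2⟩

theorem assign_mu (h : Invariant p J z s z F) (m : DecoratedPerm n) (hm : m.lift = F) :
    (assign s).mu = m.perm := by
  funext i
  obtain ⟨i, rfl⟩ := residue_surjective i
  rw [← DecoratedPerm.residue_lift, hm, assign]
  dsimp only
  by_cases e : residue n i = residue n z
  · rw [h.pos_eq, e, Function.update_self, h.carried_eq, map_eq_of_residue_eq h.map_add e,
      eq_comm, residue_eq_iff]
    convert residue_eq_iff.1 e using 1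
    ring
  · rw [h.pos_eq, Function.update_of_ne e, h.mu_eq i e]

theorem assign_col (h : Invariant p J z s z F) (m : DecoratedPerm n) (hm : m.lift = F) :
    (assign s).col' = m.partialCol := by
  have hn := natCast_pos_int (n := n)
  have h1 := h.J_lt
  have h2 := h.lt_J
  have h3 := h.carried_le
  funext i
  obtain ⟨i, rfl⟩ := residue_surjective i
  rw [DecoratedPerm.partialCol_residue, hm, assign]
  dsimp only
  have hqa : s.q = s.a ↔ F z = z + n := by
    rw [h.carried_eq, h.pos_eq, ← residue_add_self z,
      residue_eq_iff_of_mem (by omega) (by omega)]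
  by_cases e : residue n i = residue n z
  · have h4 := map_eq_of_residue_eq h.map_add e
    rw [if_neg (show ¬ F i = i by omega), e]
    by_cases e2 : F z = z + n
    · rw [if_pos (hqa.2 e2), if_pos (by omega), h.pos_eq, Function.update_self]
    · rw [if_neg (hqa.not.2 e2), if_neg (by omega), h.col_z]
  · rw [← h.col_eq i e]
    split_ifs
    · rw [h.pos_eq, Function.update_of_ne e]
    · rfl

theorem positroid_eq (hJ : p.perm (residue n J) ≠ residue n J) (hz : p.lift z = J)
    (h : Invariant p J z s z F) (m : DecoratedPerm n) (hm : m.lift = F) :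
    m.positroid = setRestriction p.positroid {residue n J}ᶜ := by
  obtain ⟨hz1, hz2⟩ := preimage_bounds hJ hz
  subst hm
  refine p.positroid_eq_setRestriction m J (fun e => hJ ?_) h.chords_out ?_ ?_
  · rw [← DecoratedPerm.residue_lift, e, residue_add_self]
  · intro t x i h1 h2 h3 h4 h5
    rcases (show (z < i ∨ i = z) ∨ t ≤ z by omega) with c | c
    · exact h.chords_of_chord t x i h1 h2 c h3 h4 h5
    · exact h.chords_of_chord t x z c hz1.le (Or.inr rfl) hz.ge (by omega) h5
  · intro t x h1 h2 h3 h4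
    exact h.chords_of_no_chord t x h1 h2 h3 fun i a b _ => h4 i a b

end Invariant

/-- The algorithm terminates, and its output is the decorated permutation of the deletion. -/
theorem exists_outputs_positroid_eq (hJ : p.perm (residue n J) ≠ residue n J) :
    ∃ m : DecoratedPerm n, Outputs p (residue n J) m ∧
      m.positroid = setRestriction p.positroid {residue n J}ᶜ := by
  obtain ⟨z, hz⟩ := p.isBoundedAffine_lift.bijective.2 J
  obtain ⟨s, F, hloop, h⟩ := (invariant_init hJ hz).loop hJ hz
  obtain ⟨m, hm⟩ := DecoratedPerm.exists_lift_eq h.isBoundedAffine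
  exact ⟨m, ⟨s, hloop, h.assign_mu m hm, h.assign_col m hm⟩, h.positroid_eq hJ hz m hm⟩

end RestrictionAlg

/-! ### The three cases of the theorem. -/

theorem mainTheorem2 (n : ℕ) [NeZero n] (p : DecoratedPerm n) (j : Fin n) :
    (p.perm j ≠ j →
      ∃ m : DecoratedPerm n, RestrictionAlg.Outputs p j m ∧
        m.positroid = setRestriction p.positroid {j}ᶜ ∧
        ∀ m' : DecoratedPerm n,
          IsDecoratedPermOf m' (setRestriction p.positroid {j}ᶜ) ↔ m' = m) ∧
    (∀ h : p.perm j = j, p.col ⟨j, h⟩ = 1 →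
      p.positroid = setRestriction p.positroid {j}ᶜ ∧
      ∀ m' : DecoratedPerm n,
        IsDecoratedPermOf m' (setRestriction p.positroid {j}ᶜ) ↔ m' = p) ∧
    (∀ h : p.perm j = j, p.col ⟨j, h⟩ = -1 →
      setRestriction p.positroid {j}ᶜ = ∅ ∧
      ∀ m' : DecoratedPerm n,
        IsDecoratedPermOf m' (setRestriction p.positroid {j}ᶜ) ↔
          m' = DecoratedPerm.trivial n) := by
  obtain ⟨J, rfl⟩ := residue_surjective j
  refine ⟨fun hj => ?_, fun h hc => ?_, fun h hc => ?_⟩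
  · obtain ⟨m, hm, hpos⟩ := RestrictionAlg.exists_outputs_positroid_eq hj
    refine ⟨m, hm, hpos, fun m' => ?_⟩
    rw [← hpos, DecoratedPerm.isDecoratedPermOf_positroid_iff]
  · have hpos := p.positroid_eq_setRestriction_of_lift_eq_self
      ((p.lift_eq_self_iff J).2 ⟨h, by rw [hc]; decide⟩)
    refine ⟨hpos, fun m' => ?_⟩
    rw [← hpos, DecoratedPerm.isDecoratedPermOf_positroid_iff]
  · have hempty := p.setRestriction_eq_empty_of_lift_eq_add ((p.lift_eq_add_iff J).2 ⟨h, hc⟩)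
    refine ⟨hempty, fun m' => ?_⟩
    rw [hempty, DecoratedPerm.isDecoratedPermOf_empty_iff]
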